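/- \textbf{Setting.} Let $\mathcal S,\mathcal A$ be finite sets, let $P(s'\mid s,a)$ be transition probabilities, $r(s,a,s')$ rewards with $|r|\le 1$, $\gamma\in[0,1)$ a discount factor and $\beta(a\mid s)$ a behavior policy. Let $R(s,a)=\sum_{s'}P(s'\mid s,a)r(s,a,s')$, and let $Q^*=\max_\pi Q^\pi$ be the optimal Q-function, the maximum being over deterministic policies. Let $(s_k,a_k)_{k\ge0}$ be a Markov chain on $\mathcal S\times\mathcal A$, with any initial distribution, and with transition probabilities $P(s'\mid s,a)\beta(a'\mid s')$; assume that the chain is irreducible and aperiodic. Put $\mu_\infty(s,a)=\lim_{k}\mathbb P[s_k=s,a_k=a]$, $D_\infty=\mathrm{diag}(\mu_\infty)$, $d_{\min}=\min\mu_\infty$, $d_{\max}=\max\mu_\infty$. For a vector $Q$ let $(\Pi_QQ)(s)=\max_uQ(s,u)$. \textbf{Step-size.} $\alpha_k=\theta/(k+\xi)$, where, for some constant $c>0$, $$\frac{2}{(1-\gamma)d_{\min}}\le\theta\le \frac{c\,|\mathcal S||\mathcal A|}{(1-\gamma)d_{\min}},\qquad \theta\le\xi\le \frac{c\,(|\mathcal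 S||\mathcal A|)^{6}d_{\max}^{3}}{(1-\gamma)^{3}d_{\min}^{3}} .$$ \textbf{Q-learning and the lower comparison system.} Let $\|Q_0\|_\infty\le1$, $\|Q^L_0\|_\infty\le1$ be deterministic, and $$Q_{k+1}=Q_k+\alpha_k\big(D_\infty R+\gamma D_\infty P\Pi_{Q_k}Q_k-D_\infty Q_k+w_k\big),$$ $$w_k=(e_{a_k}\otimes e_{s_k})\big(r(s_k,a_k,s_{k+1})+\gamma\max_uQ_k(s_{k+1},u)-Q_k(s_k,a_k)\big)-\big(D_\infty R+\gamma D_\infty P\Pi_{Q_k}Q_k-D_\infty Q_k\big),$$ $$Q^L_{k+1}-Q^*=(I+\alpha_kT)(Q^L_k-Q^*)+\alpha_kw_k,\qquad T=\gamma D_\infty P\Pi_{Q^*}-D_\infty ,$$ where in $T$ the matrix $\Pi_{Q^*}$ is that of any greedy policy for $Q^*$. \textbf{Mixing.} There exist $m>0$ and $\rho\in(0,1)$ such that, whatever the initial distribution, the law of $(s_k,a_k)$ is within total variation distance $m\rho^k$ of $\mu_\infty$ for all $k\ge 0$. For any such $m,\rho$ let $\tau^{\mathrm{mix}}(x)=\min\{k\in\mathbb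 N: m\rho^k\le x\}$ (where $0\in\mathbb N$) and $K_{\mathrm{mix}}=\min\{k: t\ge2\tau^{\mathrm{mix}}(\alpha_t)\ \forall t\ge k\}$. \textbf{Theorem.} For every $c>0$ there is a constant $C>0$, depending only on $c$, such that for all data as above (with this $c$) and all $k\ge K_{\mathrm{mix}}$, $$\mathbb E\big[\|Q^L_k-Q^*\|_\infty\big]\le\frac{C^L}{\sqrt{k+\xi}}+\frac{C(|\mathcal S||\mathcal A|)^{25/8}}{(1-\gamma)^3d_{\min}^2}\,\frac{\sqrt{\tau^{\mathrm{mix}}(\alpha_k)}}{\sqrt{k+\xi}},$$ $$C^L=C\max\left\{\frac{(|\mathcal S||\mathcal A|)^3d_{\max}^{3/2}}{(1-\gamma)^{3/2}d_{\min}^{3/2}}\,\|Q^L_0-Q^*\|_2,\ \frac{(|\mathcal S||\mathcal A|)^{11/4}}{(1-\gamma)^3d_{\min}^2}\right\}.$$ -/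

import Mathlib

open MeasureTheory Filter Topology

noncomputable section

namespace QLearning

/-- A finite discounted Markov decision process: transition probabilities `P s a s'`,
rewards `r s a s'`, discount factor `γ ∈ [0, 1)`. -/
structure MDP (S A : Type*) [Fintype S] where
  P : S → A → S → ℝ
  P_mem : ∀ s a, P s a ∈ stdSimplex ℝ S
  r : S → A → S → ℝ
  γ : ℝ
  γ_nonneg : 0 ≤ γ
  γ_lt_one : γ < 1

variable {S A Ω : Type*} [Fintype S] [Fintype A] [DecidableEq S] [DecidableEq A]

/-- The expected reward `R(s, a)`. -/
def MDP.R (M : MDP S A) (x : S × A) : ℝ := ∑ s', M.P x.1 x.2 s' * M.r x.1 x.2 s'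

/-- The matrix `P Π_π` on state-action pairs, for a deterministic policy `π`. -/
def MDP.policyMatrix (M : MDP S A) (π : S → A) : Matrix (S × A) (S × A) ℝ :=
  fun x y => if y.2 = π y.1 then M.P x.1 x.2 y.1 else 0

/-- The Q-function of `π`: `Q^π(s, a) = E[∑ γ^n r_{n+1} | s_0 = s, a_0 = a, π]`. -/
def MDP.policyQ (M : MDP S A) (π : S → A) (x : S × A) : ℝ :=
  ∑' n : ℕ, M.γ ^ n * ((M.policyMatrix π ^ n).mulVec M.R) x

/-- The optimal Q-function `Q*`. -/
def MDP.optQ (M : MDP S A) (x : S × A) : ℝ := ⨆ π : S → A, M.policyQ π x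

/-- `π` is a greedy policy for `Q` (with an arbitrary way of breaking ties). -/
def IsGreedy (Q : S × A → ℝ) (π : S → A) : Prop := ∀ s a, Q (s, a) ≤ Q (s, π s)

/-- The transition matrix of the chain `(s_k, a_k)` under the behavior policy `β`. -/
def MDP.chain (M : MDP S A) (β : S → A → ℝ) : Matrix (S × A) (S × A) ℝ :=
  fun x y => M.P x.1 x.2 y.1 * β y.1 y.2

/-- Every period of every state is one. -/
def IsAperiodic {X : Type*} [Fintype X] [DecidableEq X] (K : Matrix X X ℝ) : Prop :=
  ∀ (x : X) (d : ℕ), (∀ n : ℕ, 0 < n → 0 < (K ^ n) x x → d ∣ n) → d = 1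

/-- `X` is a (time-homogeneous) Markov chain with transition matrix `K` and an arbitrary
initial distribution. -/
structure IsMarkovChain {X : Type*} [MeasurableSpace Ω] (μ : Measure Ω)
    (K : Matrix X X ℝ) (Z : ℕ → Ω → X) : Prop where
  measurableSet_eq : ∀ k x, MeasurableSet {ω | Z k ω = x}
  markov : ∀ (n : ℕ) (x : ℕ → X),
    μ.real {ω | ∀ i ≤ n + 1, Z i ω = x i} =
      μ.real {ω | ∀ i ≤ n, Z i ω = x i} * K (x n) (x (n + 1))

/-- The limit distribution `μ_∞(x) = lim_k ℙ[Z_k = x]`. -/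
def limitLaw {X : Type*} [MeasurableSpace Ω] (μ : Measure Ω) (Z : ℕ → Ω → X) (x : X) : ℝ :=
  limUnder atTop (fun k => μ.real {ω | Z k ω = x})

/-- Total variation distance between two distributions on a finite type. -/
def tvDist {X : Type*} [Fintype X] (p q : X → ℝ) : ℝ :=
  ⨆ E : Finset X, |∑ x ∈ E, p x - ∑ x ∈ E, q x|

/-- Geometric mixing with constants `m > 0`, `ρ ∈ (0, 1)`: whatever the initial state, the
law of the chain at time `k` is within `m ρ ^ k` of `p` in total variation. -/
def IsMixing {X : Type*} [Fintype X] [DecidableEq X] (K : Matrix X X ℝ) (p : X → ℝ)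
    (m ρ : ℝ) : Prop :=
  0 < m ∧ 0 < ρ ∧ ρ < 1 ∧ ∀ (x : X) (k : ℕ), tvDist ((K ^ k) x) p ≤ m * ρ ^ k

/-- The mixing time `τ(c) = min {k | m ρ ^ k ≤ c}`. -/
def mixTime (m ρ c : ℝ) : ℕ := sInf {k : ℕ | m * ρ ^ k ≤ c}

/-- `min {k | t ≥ 2 τ(α_t) for all t ≥ k}`. -/
def kMix (m ρ : ℝ) (α : ℕ → ℝ) : ℕ := sInf {k : ℕ | ∀ t ≥ k, 2 * mixTime m ρ (α t) ≤ t}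

/-- The step-size `α_k = θ / (k + ξ)`. -/
def stepSize (θ ξ : ℝ) (k : ℕ) : ℝ := θ / (k + ξ)

/-- The vector `(e_a ⊗ e_s) (r(s, a, s') + γ max_u Q(s', u) - Q(s, a))`, with `x = (s, a)`. -/
def MDP.sampleDrift (M : MDP S A) (Q : S × A → ℝ) (x : S × A) (s' : S) : S × A → ℝ :=
  Pi.single x (M.r x.1 x.2 s' + M.γ * (⨆ u, Q (s', u)) - Q x)

/-- The vector `D (R + γ P Π_Q Q - Q)`, where `D = diag(d)` and `(Π_Q Q)(s) = max_u Q(s, u)`. -/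
def MDP.meanDrift (M : MDP S A) (d : S × A → ℝ) (Q : S × A → ℝ) : S × A → ℝ :=
  fun x => d x * (M.R x + M.γ * (∑ s', M.P x.1 x.2 s' * ⨆ u, Q (s', u)) - Q x)

/-- The noise `w(o, Q)` for the observation `o = (x, s')`. -/
def MDP.noise (M : MDP S A) (d : S × A → ℝ) (Q : S × A → ℝ) (x : S × A) (s' : S) :
    S × A → ℝ :=
  M.sampleDrift Q x s' - M.meanDrift d Q

/-- The Q-learning iterates along the trajectory `z k = (s_k, a_k)`:
`Q_{k+1} = Q_k + α_k (D R + γ D P Π_{Q_k} Q_k - D Q_k + w_k)`. -/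
def MDP.qIter (M : MDP S A) (d : S × A → ℝ) (α : ℕ → ℝ) (Q₀ : S × A → ℝ)
    (z : ℕ → S × A) : ℕ → S × A → ℝ
  | 0 => Q₀
  | k + 1 =>
      let Q := M.qIter d α Q₀ z k
      Q + α k • (M.meanDrift d Q + M.noise d Q (z k) (z (k + 1)).1)

/-- The matrix `T = γ D P Π_π - D`. -/
def MDP.T (M : MDP S A) (d : S × A → ℝ) (π : S → A) : Matrix (S × A) (S × A) ℝ :=
  M.γ • (Matrix.diagonal d * M.policyMatrix π) - Matrix.diagonal d

/-- The lower comparison system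
`Q^L_{k+1} - Q* = (I + α_k T) (Q^L_k - Q*) + α_k w_k`, where `T = γ D P Π_π - D` for a greedy
policy `π` of `Q*`, driven by the noise `w_k` of the Q-learning iterates `Q_k`. -/
def MDP.lowerIter (M : MDP S A) (d : S × A → ℝ) (α : ℕ → ℝ) (π : S → A)
    (Q₀ QL₀ : S × A → ℝ) (z : ℕ → S × A) : ℕ → S × A → ℝ
  | 0 => QL₀
  | k + 1 =>
      M.optQ + (1 + α k • M.T d π).mulVec (M.lowerIter d α π Q₀ QL₀ z k - M.optQ)
        + α k • M.noise d (M.qIter d α Q₀ z k) (z k) (z (k + 1)).1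

/-- The Euclidean norm. -/
def norm2 {X : Type*} [Fintype X] (v : X → ℝ) : ℝ := Real.sqrt (∑ x, v x ^ 2)

/-- `C^L`, with `n = |S||A|` and `e = ‖Q^L_0 - Q*‖_2`. -/
def constL (C n γ dmin dmax e : ℝ) : ℝ :=
  C * max (n ^ 3 * dmax ^ (3 / 2 : ℝ) / ((1 - γ) ^ (3 / 2 : ℝ) * dmin ^ (3 / 2 : ℝ)) * e)
    (n ^ (11 / 4 : ℝ) / ((1 - γ) ^ 3 * dmin ^ 2))

end QLearning

end

/-! Variation of constants (`MDP.lowerIter_sub_optQ`) splits the error of the lower system into the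
propagated initial error and a weighted sum of noise vectors. Since `I + α_k T` contracts the sup
norm by `1 - α_k (1 - γ) dmin ≤ 1 - 2 / (k + ξ)`, products of these matrices decay quadratically
(`norm_transition_mulVec_le`), and the weight of the `i`-th noise vector is `O(θ (i + ξ) / (k +
ξ)²)`.

The noise is not a martingale difference, but it is almost uncorrelated with the past at lag `τ =
mixTime m ρ (α k)`. Freezing the iterate `τ` steps earlier costs `O(τ α_{i-τ})`, because the
iterates are bounded and move slowly; with the iterate frozen, the conditional mean of the noise is
the deviation of a row of `K ^ τ` from `d` times a bounded residual, hence `O(α_k)`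
(`abs_integral_mul_noiseAt_le`). Feeding this into `IsMarkovChain.integral_sq_sum_le` bounds the
second moment of each coordinate by a multiple of `(τ + 1) θ³ / ((1 - γ)² (k + ξ))`
(`integral_sq_noise_sum_le`). Summing over coordinates and taking a root gives the rate `1 / √(k +
ξ)`; the bounds on `θ` and `ξ` then yield the stated constants.

Existence of mixing constants, and positivity of the limit law, come from Doeblin's argument applied
to a strictly positive power of the chain (`exists_isMixing`). -/

namespace QLearning

/-! ### Geometric mixing of finite irreducible aperiodic chains. -/

section Mixing

variable {X : Type*} [Fintype X]

lemma tvDist_le (p q : X → ℝ) {δ : ℝ} (h : ∀ x, |p x - q x| ≤ δ) :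
    tvDist p q ≤ Fintype.card X * δ := by
  refine ciSup_le fun E => ?_
  rw [← Finset.sum_sub_distrib]
  calc |∑ x ∈ E, (p x - q x)| ≤ ∑ x ∈ E, |p x - q x| := Finset.abs_sum_le_sum_abs _ _
    _ ≤ ∑ x, |p x - q x| :=
      Finset.sum_le_sum_of_subset_of_nonneg (Finset.subset_univ _) fun _ _ _ => abs_nonneg _
    _ ≤ ∑ _x : X, δ := Finset.sum_le_sum fun x _ => h x
    _ = _ := by simp

lemma abs_sub_le_tvDist (p q : X → ℝ) (x : X) : |p x - q x| ≤ tvDist p q := by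
  have := le_ciSup (f := fun E : Finset X => |∑ x ∈ E, p x - ∑ x ∈ E, q x|)
    (Set.finite_range _).bddAbove {x}
  simpa [tvDist] using this

variable [DecidableEq X] {K : Matrix X X ℝ}

lemma pow_add_apply_ge (hK : ∀ x y, 0 ≤ K x y) (a b : ℕ) (x y z : X) :
    (K ^ a) x y * (K ^ b) y z ≤ (K ^ (a + b)) x z := by
  rw [pow_add, Matrix.mul_apply]
  exact Finset.single_le_sum (f := fun y => (K ^ a) x y * (K ^ b) y z)
    (fun w _ => mul_nonneg (Matrix.pow_apply_nonneg hK a x w) (Matrix.pow_apply_nonneg hK b w z))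
    (Finset.mem_univ y)

/-- The return times to `x` of an aperiodic nonnegative matrix contain all large integers. -/
lemma IsAperiodic.exists_return_pos (hK : ∀ x y, 0 ≤ K x y) (ha : IsAperiodic K) (x : X) :
    ∃ N, ∀ n ≥ N, 0 < (K ^ n) x x := by
  set s : Set ℕ := {n | 0 < n ∧ 0 < (K ^ n) x x} with hs
  obtain ⟨N, hN⟩ := Nat.exists_mem_closure_of_ge s
  have hg : Nat.setGcd s = 1 :=
    ha x _ fun n hn hp => Nat.setGcd_dvd_of_mem (show n ∈ s from ⟨hn, hp⟩)
  -- Return times are closed under addition, and `0` is harmless since `K ^ 0 = 1`; a submonoid of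
  -- `ℕ` generated by a set of gcd one contains all large integers.
  have key : ∀ n ∈ AddSubmonoid.closure s, 0 < (K ^ n) x x := by
    intro n hn
    induction hn using AddSubmonoid.closure_induction with
    | mem n h => exact h.2
    | zero => simp
    | add a b _ _ iha ihb => exact (mul_pos iha ihb).trans_le (pow_add_apply_ge hK a b x x x)
  exact ⟨N, fun n hn => key n (hN n hn (by simp [hg]))⟩

/-- An irreducible aperiodic nonnegative matrix is primitive. -/
lemma IsAperiodic.exists_pow_pos (hi : K.IsIrreducible) (ha : IsAperiodic K) :
    ∃ N > 0, ∀ x y, 0 < (K ^ N) x y := by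
  have hK := hi.nonneg
  choose k _ hk using (Matrix.isIrreducible_iff_exists_pow_pos hK).1 hi
  choose R hR using ha.exists_return_pos hK
  -- One exponent serves all pairs: loop at `x` for the surplus time, which is at least `R x`, then
  -- go to `y` in `k x y` steps. The `+ 1` only ensures positivity.
  refine ⟨∑ x, ∑ y, (R x + k x y) + 1, by omega, fun x y => ?_⟩
  have h1 : R x + k x y ≤ ∑ x, ∑ y, (R x + k x y) :=
    (Finset.single_le_sum (f := fun y => R x + k x y) (fun _ _ => Nat.zero_le _)
      (Finset.mem_univ y)).trans
    (Finset.single_le_sum (f := fun x => ∑ y, (R x + k x y)) (fun _ _ => Nat.zero_le _)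
      (Finset.mem_univ x))
  set M := ∑ x, ∑ y, (R x + k x y) + 1
  have h2 : M = (M - k x y) + k x y := by omega
  rw [h2]
  exact (mul_pos (hR x _ (by omega)) (hk x y)).trans_le (pow_add_apply_ge hK _ _ x x y)

/-- Doeblin's contraction: averaging by a stochastic matrix with entries at least `ε` shrinks
the oscillation of a vector by the factor `1 - ε`. -/
lemma osc_mulVec_le [Nonempty X] {L : Matrix X X ℝ} (hL : L ∈ Matrix.rowStochastic ℝ X) {ε : ℝ}
    (hε : ∀ x y, ε ≤ L x y) (hε1 : ε ≤ 1) {f : X → ℝ} {δ : ℝ} (hf : ∀ x y, f x - f y ≤ δ)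
    (x y : X) : L.mulVec f x - L.mulVec f y ≤ (1 - ε) * δ := by
  obtain ⟨z₀, h₀⟩ := Finite.exists_min f
  obtain ⟨z₁, h₁⟩ := Finite.exists_max f
  have hL0 : ∀ i j, 0 ≤ L i j := fun i j => Matrix.nonneg_of_mem_rowStochastic hL
  have hs := Matrix.sum_row_of_mem_rowStochastic hL
  -- Row `x` gives mass at least `ε` to the minimizer `z₀`. This alone yields the factor `1 - ε`, so
  -- the trivial bound suffices for row `y`.
  have hx : L.mulVec f x ≤ f z₁ - ε * (f z₁ - f z₀) := by
    have e : f z₁ - L.mulVec f x = ∑ z, L x z * (f z₁ - f z) := by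
      simp only [mul_sub, Finset.sum_sub_distrib, ← Finset.sum_mul, hs, one_mul]
      rfl
    have : ε * (f z₁ - f z₀) ≤ ∑ z, L x z * (f z₁ - f z) :=
      (mul_le_mul_of_nonneg_right (hε x z₀) (sub_nonneg.2 (h₀ z₁))).trans
        (Finset.single_le_sum (f := fun z => L x z * (f z₁ - f z))
          (fun z _ => mul_nonneg (hL0 x z) (sub_nonneg.2 (h₁ z))) (Finset.mem_univ z₀))
    linarith
  have hy : f z₀ ≤ L.mulVec f y := by
    have e : L.mulVec f y - f z₀ = ∑ z, L y z * (f z - f z₀) := by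
      simp only [mul_sub, Finset.sum_sub_distrib, ← Finset.sum_mul, hs, one_mul]
      rfl
    have : 0 ≤ ∑ z, L y z * (f z - f z₀) :=
      Finset.sum_nonneg fun z _ => mul_nonneg (hL0 y z) (sub_nonneg.2 (h₀ z))
    linarith
  have := mul_le_mul_of_nonneg_left (hf z₁ z₀) (sub_nonneg.2 hε1)
  linarith

lemma pow_mem_rowStochastic (hK : K ∈ Matrix.rowStochastic ℝ X) (n : ℕ) :
    K ^ n ∈ Matrix.rowStochastic ℝ X := pow_mem hK n

/-- Each block of `N` steps averages the column once more and gains a factor `1 - ε`; the remaining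
`r` steps contribute only the trivial bound `1`. -/
lemma osc_pow_le [Nonempty X] (hK : K ∈ Matrix.rowStochastic ℝ X) {N : ℕ} {ε : ℝ}
    (hε : ∀ x y, ε ≤ (K ^ N) x y) (hε1 : ε ≤ 1) (q r : ℕ) (x x' y : X) :
    (K ^ (N * q + r)) x y - (K ^ (N * q + r)) x' y ≤ (1 - ε) ^ q := by
  induction q generalizing x x' with
  | zero =>
    have h1 := Matrix.le_one_of_mem_rowStochastic (pow_mem_rowStochastic hK r) (i := x) (j := y)
    have h2 := Matrix.nonneg_of_mem_rowStochastic (pow_mem_rowStochastic hK r) (i := x') (j := y)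
    simp only [mul_zero, zero_add, pow_zero]
    linarith
  | succ q ih =>
    have e : ∀ z, (K ^ (N * (q + 1) + r)) z y
        = (K ^ N).mulVec (fun z => (K ^ (N * q + r)) z y) z := by
      intro z
      rw [show N * (q + 1) + r = N + (N * q + r) by ring, pow_add K N, Matrix.mul_apply]
      rfl
    rw [e, e, pow_succ']
    exact osc_mulVec_le (pow_mem_rowStochastic hK N) hε hε1 ih x x'

/-- An irreducible aperiodic stochastic matrix on a finite type mixes geometrically, towards a
distribution with positive entries. -/
theorem exists_isMixing [Nonempty X] (hK : K ∈ Matrix.rowStochastic ℝ X) (hi : K.IsIrreducible)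
    (ha : IsAperiodic K) : ∃ p : X → ℝ, (∀ y, 0 < p y) ∧ ∃ m ρ, IsMixing K p m ρ := by
  obtain ⟨N, hN0, hN⟩ := ha.exists_pow_pos hi
  obtain ⟨ε, hε0, hε1, hε⟩ : ∃ ε : ℝ, 0 < ε ∧ ε < 1 ∧ ∀ x y, ε ≤ (K ^ N) x y := by
    obtain ⟨z, hz⟩ := Finite.exists_min fun z : X × X => (K ^ N) z.1 z.2
    -- The cap `1 / 2` keeps `1 - ε` positive, as the division by it in the mixing constant
    -- requires.
    refine ⟨min (1 / 2) ((K ^ N) z.1 z.2), lt_min (by norm_num) (hN _ _),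
      (min_le_left _ _).trans_lt (by norm_num), fun x y => (min_le_right _ _).trans (hz (x, y))⟩
  set δ : ℕ → ℝ := fun k => (1 - ε) ^ (k / N) with hδ
  have hq0 : 0 < 1 - ε := by linarith
  have hosc : ∀ k x x' y, (K ^ k) x y - (K ^ k) x' y ≤ δ k := by
    intro k x x' y
    have := osc_pow_le hK hε hε1.le (k / N) (k % N) x x' y
    rwa [Nat.div_add_mod] at this
  -- A row of `K ^ (l + k)` is an average of rows of `K ^ k`, so the oscillation bound also compares
  -- different times.
  have hcauchy : ∀ k l x x' y, |(K ^ (l + k)) x y - (K ^ k) x' y| ≤ δ k := by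
    intro k l x x' y
    have hS := pow_mem_rowStochastic hK l
    have e : (K ^ (l + k)) x y - (K ^ k) x' y
        = ∑ z, (K ^ l) x z * ((K ^ k) z y - (K ^ k) x' y) := by
      simp only [mul_sub, Finset.sum_sub_distrib, ← Finset.sum_mul,
        Matrix.sum_row_of_mem_rowStochastic hS, one_mul, pow_add, Matrix.mul_apply]
    rw [e]
    calc _ ≤ ∑ z, |(K ^ l) x z * ((K ^ k) z y - (K ^ k) x' y)| := Finset.abs_sum_le_sum_abs _ _
      _ ≤ ∑ z, (K ^ l) x z * δ k := by
        refine Finset.sum_le_sum fun z _ => ?_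
        rw [abs_mul, abs_of_nonneg (Matrix.nonneg_of_mem_rowStochastic hS)]
        refine mul_le_mul_of_nonneg_left (abs_le.2 ⟨?_, hosc k z x' y⟩)
          (Matrix.nonneg_of_mem_rowStochastic hS)
        linarith [hosc k x' z y]
      _ = δ k := by
        rw [← Finset.sum_mul, Matrix.sum_row_of_mem_rowStochastic hS, one_mul]
  have hδ0 : Tendsto δ atTop (𝓝 0) :=
    (tendsto_pow_atTop_nhds_zero_of_lt_one hq0.le (by linarith)).comp
      (Nat.tendsto_div_const_atTop hN0.ne')
  have hlim : ∀ y, ∃ p, ∀ x, Tendsto (fun k => (K ^ k) x y) atTop (𝓝 p) := by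
    intro y
    obtain ⟨x₀⟩ := ‹Nonempty X›
    have hc : CauchySeq fun k => (K ^ k) x₀ y := by
      refine cauchySeq_of_le_tendsto_0 (fun k => 2 * δ k) (fun n m k hn hm => ?_)
        (by simpa using hδ0.const_mul 2)
      obtain ⟨a, rfl⟩ := Nat.exists_eq_add_of_le' hn
      obtain ⟨b, rfl⟩ := Nat.exists_eq_add_of_le' hm
      have h1 := hcauchy k a x₀ x₀ y
      have h2 := hcauchy k b x₀ x₀ y
      rw [Real.dist_eq]
      rw [abs_le] at *
      constructor <;> linarith [h1.1, h1.2, h2.1, h2.2]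
    obtain ⟨p, hp⟩ := cauchySeq_tendsto_of_complete hc
    refine ⟨p, fun x => ?_⟩
    have : Tendsto (fun k => (K ^ k) x y - (K ^ k) x₀ y) atTop (𝓝 0) :=
      squeeze_zero_norm (fun k => by simpa using hcauchy k 0 x x₀ y) hδ0
    simpa using this.add hp
  choose p hp using hlim
  have hpδ : ∀ k x y, |(K ^ k) x y - p y| ≤ δ k := by
    intro k x y
    have h1 : Tendsto (fun l => |(K ^ (l + k)) x y - (K ^ k) x y|) atTop
        (𝓝 |p y - (K ^ k) x y|) :=
      (((tendsto_add_atTop_iff_nat k).2 (hp y x)).sub_const _).abs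
    rw [abs_sub_comm]
    exact le_of_tendsto h1 (Eventually.of_forall fun l => hcauchy k l x x y)
  -- Replacing the floor `k / N` by the real quotient loses at most one factor `1 - ε`, hence the
  -- denominator; `Fintype.card X` is the price of passing from entries to total variation.
  refine ⟨p, fun y => ?_, Fintype.card X / (1 - ε), (1 - ε) ^ (1 / (N : ℝ)), by positivity,
    by positivity, ?_, fun x k => ?_⟩
  · obtain ⟨x₀⟩ := ‹Nonempty X›
    refine hε0.trans_le (ge_of_tendsto ((tendsto_add_atTop_iff_nat N).2 (hp y x₀))
      (Eventually.of_forall fun l => ?_))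
    have hS := pow_mem_rowStochastic hK l
    rw [pow_add, Matrix.mul_apply]
    calc ε = ∑ z, (K ^ l) x₀ z * ε := by
          rw [← Finset.sum_mul, Matrix.sum_row_of_mem_rowStochastic hS, one_mul]
      _ ≤ _ := Finset.sum_le_sum fun z _ =>
        mul_le_mul_of_nonneg_left (hε z y) (Matrix.nonneg_of_mem_rowStochastic hS)
  · exact Real.rpow_lt_one hq0.le (by linarith) (by positivity)
  · refine (tvDist_le _ _ (hpδ k x)).trans ?_
    rw [div_mul_eq_mul_div, mul_div_assoc]
    refine mul_le_mul_of_nonneg_left ?_ (by positivity)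
    rw [le_div_iff₀ hq0, ← Real.rpow_natCast, ← Real.rpow_mul hq0.le, hδ]
    change (1 - ε) ^ (k / N) * (1 - ε) ≤ _
    rw [← pow_succ, ← Real.rpow_natCast]
    refine Real.rpow_le_rpow_of_exponent_ge hq0 (by linarith) ?_
    have : k < (k / N + 1) * N := Nat.lt_mul_of_div_lt (Nat.lt_succ_self _) hN0
    have h2 : (k : ℝ) ≤ ((k / N + 1 : ℕ) : ℝ) * N := by exact_mod_cast this.le
    rw [one_div_mul_eq_div, div_le_iff₀ (by exact_mod_cast hN0)]
    exact h2

lemma IsMixing.tendsto {p : X → ℝ} {m ρ : ℝ} (h : IsMixing K p m ρ) (x y : X) :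
    Tendsto (fun k => (K ^ k) x y) atTop (𝓝 (p y)) := by
  have h0 : Tendsto (fun k : ℕ => m * ρ ^ k) atTop (𝓝 0) := by
    simpa using (tendsto_pow_atTop_nhds_zero_of_lt_one h.2.1.le h.2.2.1).const_mul m
  rw [tendsto_iff_norm_sub_tendsto_zero]
  exact squeeze_zero (fun _ => norm_nonneg _)
    (fun k => (abs_sub_le_tvDist ((K ^ k) x) p y).trans (h.2.2.2 x k)) h0

/-- The mixing time is attained. -/
lemma mixTime_spec {m ρ c : ℝ} (hρ0 : 0 < ρ) (hρ1 : ρ < 1) (hc : 0 < c) :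
    m * ρ ^ mixTime m ρ c ≤ c := by
  have h0 : Tendsto (fun k : ℕ => m * ρ ^ k) atTop (𝓝 0) := by
    simpa using (tendsto_pow_atTop_nhds_zero_of_lt_one hρ0.le hρ1).const_mul m
  have hne : {k : ℕ | m * ρ ^ k ≤ c}.Nonempty := ((h0.eventually_lt_const hc).mono
    fun _ h => le_of_lt h).exists
  exact Nat.sInf_mem hne

end Mixing

/-! ### The Markov property for functions of finitely many states. -/

section Markov

variable {Ω X : Type*}

/-- The trajectory that follows the finite path `p` and then stays at its last state. -/
def extendPath {j : ℕ} (p : Fin (j + 1) → X) (i : ℕ) : X := p ⟨min i j, by omega⟩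

variable [Fintype X]

/-- A function of the first `j + 1` states is a combination of indicators of finite paths. -/
lemma eq_sum_paths {j : ℕ} {F : (ℕ → X) → ℝ} (hF : DependsOn F (Set.Iic j)) (z : ℕ → X) :
    F z = ∑ p : Fin (j + 1) → X, Set.indicator {z | ∀ i ≤ j, z i = extendPath p i}
      (fun _ => F (extendPath p)) z := by
  rw [Finset.sum_eq_single (fun a : Fin (j + 1) => z a)]
  · have h : ∀ i ≤ j, z i = extendPath (fun a : Fin (j + 1) => z a) i := fun i hi => by
      simp [extendPath, min_eq_left hi]
    rw [Set.indicator_of_mem (show z ∈ {z' : ℕ → X | ∀ i ≤ j,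
      z' i = extendPath (fun a : Fin (j + 1) => z a) i} from h)]
    exact hF h
  · intro p _ hp
    rw [Set.indicator_of_notMem]
    intro h
    refine hp (funext fun a => ?_)
    have h1 := h a (Nat.lt_succ_iff.1 a.2)
    rw [h1, extendPath]
    congr 1
    ext
    simp [Nat.lt_succ_iff.1 a.2]
  · simp

variable [MeasurableSpace Ω] {μ : Measure Ω} {K : Matrix X X ℝ} {Z : ℕ → Ω → X}

omit [Fintype X] in
lemma IsMarkovChain.measurableSet_path (h : IsMarkovChain μ K Z) (j : ℕ) (x : ℕ → X) :
    MeasurableSet {ω | ∀ i ≤ j, Z i ω = x i} := by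
  have e : {ω | ∀ i ≤ j, Z i ω = x i} = ⋂ i ∈ Set.Iic j, {ω | Z i ω = x i} := by
    ext ω
    simp
  rw [e]
  exact MeasurableSet.biInter (Set.to_countable _) fun i _ => h.measurableSet_eq i (x i)

variable [IsProbabilityMeasure μ]

omit [Fintype X] in
lemma IsMarkovChain.integrable_path (h : IsMarkovChain μ K Z) (j : ℕ) (x : ℕ → X) (a : ℝ) :
    Integrable (fun ω => Set.indicator {z | ∀ i ≤ j, z i = x i} (fun _ => a)
      (fun i => Z i ω)) μ :=
  (integrable_const (μ := μ) a).indicator (h.measurableSet_path j x)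

omit [Fintype X] [IsProbabilityMeasure μ] in
lemma IsMarkovChain.integral_path (h : IsMarkovChain μ K Z) (j : ℕ) (x : ℕ → X) (a : ℝ) :
    ∫ ω, Set.indicator {z | ∀ i ≤ j, z i = x i} (fun _ => a) (fun i => Z i ω) ∂μ
      = a * μ.real {ω | ∀ i ≤ j, Z i ω = x i} := by
  have := integral_indicator_const (μ := μ) a (h.measurableSet_path j x)
  rw [smul_eq_mul, mul_comm] at this
  exact this

/-- No measurability of `F` is needed: only finitely many paths occur up to time `j`, so the
integrand is a finite sum of indicators of measurable sets. -/
lemma IsMarkovChain.integrable (h : IsMarkovChain μ K Z) {j : ℕ} {F : (ℕ → X) → ℝ}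
    (hF : DependsOn F (Set.Iic j)) : Integrable (fun ω => F (fun i => Z i ω)) μ := by
  simp_rw +singlePass [eq_sum_paths hF]
  exact integrable_finsetSum _ fun p _ => h.integrable_path j _ _

variable [DecidableEq X]

/-- Both sides are linear in `F`, which reduces the claim to a single finite path, prolonged by `y`
at time `j + 1`; there it is the defining identity of the chain. -/
lemma IsMarkovChain.integral_mul_step (h : IsMarkovChain μ K Z) {j : ℕ} {F : (ℕ → X) → ℝ}
    (hF : DependsOn F (Set.Iic j)) (y : X) :
    ∫ ω, F (fun i => Z i ω) * (if Z (j + 1) ω = y then 1 else 0) ∂μ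
      = ∫ ω, F (fun i => Z i ω) * K (Z j ω) y ∂μ := by
  let x' : (Fin (j + 1) → X) → ℕ → X := fun p => Function.update (extendPath p) (j + 1) y
  have hx' : ∀ p, ∀ i ≤ j, x' p i = extendPath p i := fun p i hi =>
    Function.update_of_ne (by omega) _ _
  have hx1 : ∀ p, x' p (j + 1) = y := fun p => Function.update_self _ _ _
  have e1 : ∀ ω, F (fun i => Z i ω) * (if Z (j + 1) ω = y then 1 else 0)
      = ∑ p, Set.indicator {z | ∀ i ≤ j + 1, z i = x' p i} (fun _ => F (extendPath p))
          (fun i => Z i ω) := by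
    intro ω
    rw [eq_sum_paths hF, Finset.sum_mul]
    refine Finset.sum_congr rfl fun p _ => ?_
    have : (fun i => Z i ω) ∈ {z | ∀ i ≤ j + 1, z i = x' p i} ↔
        (fun i => Z i ω) ∈ {z | ∀ i ≤ j, z i = extendPath p i} ∧ Z (j + 1) ω = y := by
      constructor
      · intro H
        exact ⟨fun i hi => (H i (by omega)).trans (hx' p i hi), (H _ le_rfl).trans (hx1 p)⟩
      · rintro ⟨H1, H2⟩ i hi
        rcases Nat.lt_or_ge j i with h' | h'
        · obtain rfl : i = j + 1 := by omega
          exact H2.trans (hx1 p).symm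
        · exact (H1 i h').trans (hx' p i h').symm
    simp only [Set.indicator, this]
    split_ifs <;> simp_all
  have e2 : ∀ ω, F (fun i => Z i ω) * K (Z j ω) y
      = ∑ p : Fin (j + 1) → X, Set.indicator {z | ∀ i ≤ j, z i = extendPath p i}
          (fun _ => F (extendPath p) * K (extendPath p j) y) (fun i => Z i ω) := by
    intro ω
    rw [eq_sum_paths hF, Finset.sum_mul]
    refine Finset.sum_congr rfl fun p _ => ?_
    by_cases H : (fun i => Z i ω) ∈ {z | ∀ i ≤ j, z i = extendPath p i}
    · rw [Set.indicator_of_mem H, Set.indicator_of_mem H, show Z j ω = _ from H j le_rfl]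
    · rw [Set.indicator_of_notMem H, Set.indicator_of_notMem H, zero_mul]
  simp_rw [e1, e2]
  rw [integral_finsetSum _ fun p _ => h.integrable_path _ _ _,
    integral_finsetSum _ fun p _ => h.integrable_path _ _ _]
  refine Finset.sum_congr rfl fun p _ => ?_
  rw [h.integral_path, h.integral_path, h.markov j (x' p), hx1, hx' p j le_rfl]
  have : {ω | ∀ i ≤ j, Z i ω = x' p i} = {ω | ∀ i ≤ j, Z i ω = extendPath p i} := by
    ext ω
    exact forall₂_congr fun i hi => by rw [hx' p i hi]
  rw [this]
  ring

omit [Fintype X] [DecidableEq X] in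
lemma dependsOn_coord {j t : ℕ} (h : j ≤ t) (g : X → ℝ) :
    DependsOn (fun z : ℕ → X => g (z j)) (Set.Iic t) :=
  fun _ _ hz => congrArg g (hz j h)

omit [Fintype X] [DecidableEq X] in
lemma dependsOn_mul {F G : (ℕ → X) → ℝ} {s : Set ℕ} (hF : DependsOn F s) (hG : DependsOn G s) :
    DependsOn (fun z => F z * G z) s :=
  fun _ _ hz => congrArg₂ _ (hF hz) (hG hz)

omit [Fintype X] [DecidableEq X] in
lemma dependsOn_mono {E : Type*} {F : (ℕ → X) → E} {j t : ℕ} (hF : DependsOn F (Set.Iic j))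
    (h : j ≤ t) : DependsOn F (Set.Iic t) :=
  fun _ _ hz => hF fun i hi => hz i (le_trans hi h)

/-- The Markov property after `t` steps. -/
lemma IsMarkovChain.integral_mul_pow (h : IsMarkovChain μ K Z) {j : ℕ} {F : (ℕ → X) → ℝ}
    (hF : DependsOn F (Set.Iic j)) (t : ℕ) (y : X) :
    ∫ ω, F (fun i => Z i ω) * (if Z (j + t) ω = y then 1 else 0) ∂μ
      = ∫ ω, F (fun i => Z i ω) * (K ^ t) (Z j ω) y ∂μ := by
  induction t generalizing y with
  | zero => simp [Matrix.one_apply]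
  | succ t ih =>
    rw [← add_assoc, h.integral_mul_step (dependsOn_mono hF (Nat.le_add_right j t)) y]
    have e1 : ∀ ω, F (fun i => Z i ω) * K (Z (j + t) ω) y
        = ∑ x, F (fun i => Z i ω) * (if Z (j + t) ω = x then 1 else 0) * K x y := by
      intro ω
      rw [Finset.sum_eq_single (Z (j + t) ω)]
      · simp
      · intro x _ hx
        simp [hx.symm]
      · simp
    have e2 : ∀ ω, F (fun i => Z i ω) * (K ^ (t + 1)) (Z j ω) y
        = ∑ x, F (fun i => Z i ω) * (K ^ t) (Z j ω) x * K x y := by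
      intro ω
      rw [pow_succ, Matrix.mul_apply, Finset.mul_sum]
      exact Finset.sum_congr rfl fun x _ => by ring
    simp_rw [e1, e2]
    rw [integral_finsetSum, integral_finsetSum]
    · refine Finset.sum_congr rfl fun x _ => ?_
      rw [integral_mul_const, integral_mul_const, ih]
    · exact fun x _ => (h.integrable (dependsOn_mul hF
        (dependsOn_coord le_rfl fun z => (K ^ t) z x))).mul_const _
    · exact fun x _ => (h.integrable (dependsOn_mul (dependsOn_mono hF (Nat.le_add_right j t))
        (dependsOn_coord le_rfl fun z => if z = x then (1 : ℝ) else 0))).mul_const _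

/-- The limit law of a mixing Markov chain. -/
lemma IsMarkovChain.limitLaw_eq (h : IsMarkovChain μ K Z) {p : X → ℝ}
    {m ρ : ℝ} (hm : IsMixing K p m ρ) : limitLaw μ Z = p := by
  funext y
  refine Tendsto.limUnder_eq ?_
  -- The law at time `k` is the mixture of the rows of `K ^ k` by the initial law, and every row has
  -- the same limit.
  have e : ∀ k, μ.real {ω | Z k ω = y}
      = ∑ x, (∫ ω, (if Z 0 ω = x then 1 else 0) ∂μ) * (K ^ k) x y := by
    intro k
    have h1 := h.integral_mul_pow (j := 0) (F := fun _ => 1) (fun _ _ _ => rfl) k y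
    simp only [one_mul, zero_add] at h1
    have h2 : μ.real {ω | Z k ω = y} = ∫ ω, (if Z k ω = y then 1 else 0) ∂μ := by
      have := integral_indicator_const (μ := μ) (1 : ℝ) (h.measurableSet_eq k y)
      rw [smul_eq_mul, mul_one] at this
      rw [← this]
      simp only [Set.indicator, Set.mem_ofPred_eq]
    rw [h2, h1]
    have e1 : ∀ ω, (K ^ k) (Z 0 ω) y = ∑ x, (if Z 0 ω = x then 1 else 0) * (K ^ k) x y := by
      intro ω
      simp
    simp_rw [e1]
    rw [integral_finsetSum]
    · exact Finset.sum_congr rfl fun x _ => integral_mul_const _ _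
    · exact fun x _ => (h.integrable (dependsOn_coord le_rfl
        fun z => if z = x then (1 : ℝ) else 0)).mul_const _
  have h1 : ∑ x, (∫ ω, (if Z 0 ω = x then (1 : ℝ) else 0) ∂μ) = 1 := by
    rw [← integral_finsetSum]
    · simp
    · exact fun x _ => h.integrable (dependsOn_coord le_rfl
        fun z => if z = x then (1 : ℝ) else 0)
  simp_rw [e]
  have := tendsto_finsetSum Finset.univ fun x (_ : x ∈ Finset.univ) =>
    (hm.tendsto x y).const_mul (∫ ω, (if Z 0 ω = x then (1 : ℝ) else 0) ∂μ)
  rwa [← Finset.sum_mul, h1, one_mul] at this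

end Markov

/-! ### Products of the system matrices. -/

section Transition

variable {X : Type*} [Fintype X] [DecidableEq X]

/-- The product `L (k - 1) * ⋯ * L i` (and `1` when `k ≤ i`). -/
noncomputable def transition (L : ℕ → Matrix X X ℝ) (i : ℕ) : ℕ → Matrix X X ℝ
  | 0 => 1
  | k + 1 => if i ≤ k then L k * transition L i k else 1

lemma transition_self (L : ℕ → Matrix X X ℝ) (k : ℕ) : transition L k k = 1 := by
  cases k with
  | zero => rfl
  | succ k => simp [transition]

lemma transition_succ (L : ℕ → Matrix X X ℝ) {i k : ℕ} (h : i ≤ k) :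
    transition L i (k + 1) = L k * transition L i k := by
  simp [transition, h]

/-- Variation of constants for a linear recursion. -/
lemma eq_transition_add_sum (L : ℕ → Matrix X X ℝ) (v g : ℕ → X → ℝ)
    (h : ∀ k, v (k + 1) = (L k).mulVec (v k) + g k) (k : ℕ) :
    v k = (transition L 0 k).mulVec (v 0)
      + ∑ i ∈ Finset.range k, (transition L (i + 1) k).mulVec (g i) := by
  induction k with
  | zero => simp [transition]
  | succ k ih =>
    rw [h, Finset.sum_range_succ, transition_self, Matrix.one_mulVec,
      transition_succ L (Nat.zero_le k), ← Matrix.mulVec_mulVec, ← add_assoc]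
    congr 1
    conv_lhs => rw [ih]
    rw [Matrix.mulVec_add, Matrix.mulVec_sum]
    congr 1
    refine Finset.sum_congr rfl fun i hi => ?_
    rw [transition_succ L (Nat.succ_le_of_lt (Finset.mem_range.1 hi)), Matrix.mulVec_mulVec]

/-- Decay of the transition matrices for factors of norm at most `1 - 2 / (k + ξ)`. -/
lemma norm_transition_mulVec_le {L : ℕ → Matrix X X ℝ} {ξ : ℝ} (hξ : 2 ≤ ξ)
    (hL : ∀ k v, ‖(L k).mulVec v‖ ≤ (1 - 2 / (k + ξ)) * ‖v‖) {i k : ℕ} (hik : i ≤ k)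
    (v : X → ℝ) :
    ‖(transition L i k).mulVec v‖ ≤ ((i + ξ - 1) / (k + ξ - 1)) ^ 2 * ‖v‖ := by
  induction k, hik using Nat.le_induction with
  | base =>
    have : (i + ξ - 1 : ℝ) ≠ 0 := by
      have := Nat.cast_nonneg (α := ℝ) i
      linarith
    rw [transition_self, Matrix.one_mulVec, div_self this]
    simp
  | succ k hk ih =>
    have hk0 := Nat.cast_nonneg (α := ℝ) k
    rw [transition_succ L hk, ← Matrix.mulVec_mulVec]
    have h1 : (0 : ℝ) < k + ξ := by linarith
    have h2 : (0 : ℝ) < k + ξ - 1 := by linarith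
    have h3 : 0 ≤ 1 - 2 / (k + ξ) := by
      rw [sub_nonneg, div_le_one h1]
      linarith
    calc _ ≤ (1 - 2 / (k + ξ)) * ‖(transition L i k).mulVec v‖ := hL _ _
      _ ≤ (1 - 2 / (k + ξ)) * (((i + ξ - 1) / (k + ξ - 1)) ^ 2 * ‖v‖) :=
        mul_le_mul_of_nonneg_left ih h3
      -- The bound `1 - 2 / x ≤ (1 - 1 / x)²` at `x = k + ξ` makes the product telescope.
      _ ≤ ((k + ξ - 1) / (k + ξ)) ^ 2 * (((i + ξ - 1) / (k + ξ - 1)) ^ 2 * ‖v‖) := by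
        refine mul_le_mul_of_nonneg_right ?_ (by positivity)
        have e : ((k + ξ - 1) / (k + ξ)) ^ 2 - (1 - 2 / (k + ξ)) = (1 / (k + ξ)) ^ 2 := by
          field_simp
          ring
        have := sq_nonneg (1 / (k + ξ))
        linarith
      _ = _ := by
        push_cast
        have h4 : (k + 1 + ξ - 1 : ℝ) = k + ξ := by ring
        rw [h4]
        field_simp

end Transition

/-! ### Deterministic bounds for iterates, noise and system matrix. -/

section Bounds

variable {S A : Type*} [Fintype S] (M : MDP S A)

lemma MDP.sum_P (s : S) (a : A) : ∑ s', M.P s a s' = 1 := (M.P_mem s a).2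

lemma MDP.P_nonneg (s : S) (a : A) (s' : S) : 0 ≤ M.P s a s' := (M.P_mem s a).1 s'

lemma MDP.abs_sum_P_mul_le (s : S) (a : A) {f : S → ℝ} {b : ℝ} (h : ∀ s', |f s'| ≤ b) :
    |∑ s', M.P s a s' * f s'| ≤ b := by
  calc _ ≤ ∑ s', |M.P s a s' * f s'| := Finset.abs_sum_le_sum_abs _ _
    _ ≤ ∑ s', M.P s a s' * b := by
      refine Finset.sum_le_sum fun s' _ => ?_
      rw [abs_mul, abs_of_nonneg (M.P_nonneg s a s')]
      exact mul_le_mul_of_nonneg_left (h s') (M.P_nonneg s a s')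
    _ = b := by rw [← Finset.sum_mul, M.sum_P, one_mul]

lemma MDP.abs_R_le (hr : ∀ s a s', |M.r s a s'| ≤ 1) (x : S × A) : |M.R x| ≤ 1 :=
  M.abs_sum_P_mul_le x.1 x.2 (hr x.1 x.2)

variable [Fintype A]

lemma abs_iSup_sub_iSup_le [Nonempty A] (Q Q' : S × A → ℝ) (s : S) :
    |(⨆ u, Q (s, u)) - ⨆ u, Q' (s, u)| ≤ ‖Q - Q'‖ := by
  have key : ∀ Q Q' : S × A → ℝ, (⨆ u, Q (s, u)) - ⨆ u, Q' (s, u) ≤ ‖Q - Q'‖ := by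
    intro Q Q'
    rw [sub_le_iff_le_add]
    refine ciSup_le fun u => ?_
    have h1 := le_ciSup (Set.finite_range fun u => Q' (s, u)).bddAbove u
    have h2 := (le_abs_self _).trans (norm_le_pi_norm (Q - Q') (s, u))
    simp only [Pi.sub_apply] at h1 h2
    linarith
  rw [abs_le]
  have := key Q' Q
  rw [norm_sub_rev] at this
  exact ⟨by linarith, key Q Q'⟩

lemma abs_iSup_le [Nonempty A] (Q : S × A → ℝ) (s : S) : |⨆ u, Q (s, u)| ≤ ‖Q‖ := by
  simpa using abs_iSup_sub_iSup_le Q 0 s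

/-- The expected temporal difference `(R + γ P Π_Q Q - Q)(x)`. -/
noncomputable def MDP.residual (Q : S × A → ℝ) (x : S × A) : ℝ :=
  M.R x + M.γ * (∑ s', M.P x.1 x.2 s' * ⨆ u, Q (s', u)) - Q x

variable [Nonempty A]

lemma MDP.abs_residual_le (hr : ∀ s a s', |M.r s a s'| ≤ 1) {Q : S × A → ℝ}
    (hQ : ‖Q‖ ≤ 1 / (1 - M.γ)) (x : S × A) : |M.residual Q x| ≤ 2 / (1 - M.γ) := by
  have h0 : 0 < 1 - M.γ := sub_pos.2 M.γ_lt_one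
  have h1 := M.abs_R_le hr x
  have h2 : |M.γ * ∑ s', M.P x.1 x.2 s' * ⨆ u, Q (s', u)| ≤ M.γ * (1 / (1 - M.γ)) := by
    rw [abs_mul, abs_of_nonneg M.γ_nonneg]
    exact mul_le_mul_of_nonneg_left
      (M.abs_sum_P_mul_le _ _ fun s' => (abs_iSup_le Q s').trans hQ) M.γ_nonneg
  have h3 := (norm_le_pi_norm Q x).trans hQ
  rw [Real.norm_eq_abs] at h3
  have e : 1 + M.γ * (1 / (1 - M.γ)) + 1 / (1 - M.γ) = 2 / (1 - M.γ) := by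
    field_simp
    ring
  rw [MDP.residual, ← e]
  rw [abs_le] at *
  constructor <;> linarith [h1.1, h1.2, h2.1, h2.2, h3.1, h3.2]

lemma MDP.abs_residual_sub_le (Q Q' : S × A → ℝ) (x : S × A) :
    |M.residual Q x - M.residual Q' x| ≤ 2 * ‖Q - Q'‖ := by
  have e : M.residual Q x - M.residual Q' x
      = M.γ * (∑ s', M.P x.1 x.2 s' * ((⨆ u, Q (s', u)) - ⨆ u, Q' (s', u))) - (Q - Q') x := by
    simp only [MDP.residual, mul_sub, Finset.sum_sub_distrib, Pi.sub_apply]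
    ring
  have h2 : |M.γ * ∑ s', M.P x.1 x.2 s' * ((⨆ u, Q (s', u)) - ⨆ u, Q' (s', u))|
      ≤ 1 * ‖Q - Q'‖ := by
    rw [abs_mul, abs_of_nonneg M.γ_nonneg]
    exact mul_le_mul M.γ_lt_one.le
      (M.abs_sum_P_mul_le _ _ fun s' => abs_iSup_sub_iSup_le Q Q' s') (abs_nonneg _) zero_le_one
  have h3 := norm_le_pi_norm (Q - Q') x
  rw [Real.norm_eq_abs] at h3
  rw [e]
  rw [abs_le] at *
  constructor <;> linarith [h2.1, h2.2, h3.1, h3.2]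

/-- The temporal difference of a transition to `s'`. -/
noncomputable def MDP.tdError (Q : S × A → ℝ) (x : S × A) (s' : S) : ℝ :=
  M.r x.1 x.2 s' + M.γ * (⨆ u, Q (s', u)) - Q x

omit [Nonempty A] [Fintype A] in
lemma MDP.sum_P_mul_tdError (Q : S × A → ℝ) (x : S × A) :
    ∑ s', M.P x.1 x.2 s' * M.tdError Q x s' = M.residual Q x := by
  simp only [MDP.tdError, MDP.residual, MDP.R, mul_sub, mul_add, Finset.sum_sub_distrib,
    Finset.sum_add_distrib, ← Finset.sum_mul, M.sum_P, Finset.mul_sum]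
  rw [one_mul]
  congr 2
  exact Finset.sum_congr rfl fun _ _ => by ring

lemma MDP.abs_tdError_le (hr : ∀ s a s', |M.r s a s'| ≤ 1) {Q : S × A → ℝ}
    (hQ : ‖Q‖ ≤ 1 / (1 - M.γ)) (x : S × A) (s' : S) : |M.tdError Q x s'| ≤ 2 / (1 - M.γ) := by
  have h0 : 0 < 1 - M.γ := sub_pos.2 M.γ_lt_one
  have h1 := hr x.1 x.2 s'
  have h2 : |M.γ * ⨆ u, Q (s', u)| ≤ M.γ * (1 / (1 - M.γ)) := by
    rw [abs_mul, abs_of_nonneg M.γ_nonneg]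
    exact mul_le_mul_of_nonneg_left ((abs_iSup_le Q s').trans hQ) M.γ_nonneg
  have h3 := (norm_le_pi_norm Q x).trans hQ
  rw [Real.norm_eq_abs] at h3
  have e : 1 + M.γ * (1 / (1 - M.γ)) + 1 / (1 - M.γ) = 2 / (1 - M.γ) := by
    field_simp
    ring
  rw [MDP.tdError, ← e]
  rw [abs_le] at *
  constructor <;> linarith [h1.1, h1.2, h2.1, h2.2, h3.1, h3.2]

lemma MDP.abs_tdError_sub_le (Q Q' : S × A → ℝ) (x : S × A) (s' : S) :
    |M.tdError Q x s' - M.tdError Q' x s'| ≤ 2 * ‖Q - Q'‖ := by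
  have e : M.tdError Q x s' - M.tdError Q' x s'
      = M.γ * ((⨆ u, Q (s', u)) - ⨆ u, Q' (s', u)) - (Q - Q') x := by
    simp only [MDP.tdError, Pi.sub_apply]
    ring
  have h2 : |M.γ * ((⨆ u, Q (s', u)) - ⨆ u, Q' (s', u))| ≤ 1 * ‖Q - Q'‖ := by
    rw [abs_mul, abs_of_nonneg M.γ_nonneg]
    exact mul_le_mul M.γ_lt_one.le (abs_iSup_sub_iSup_le Q Q' s') (abs_nonneg _) zero_le_one
  have h3 := norm_le_pi_norm (Q - Q') x
  rw [Real.norm_eq_abs] at h3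
  rw [e]
  rw [abs_le] at *
  constructor <;> linarith [h2.1, h2.2, h3.1, h3.2]

variable [DecidableEq S] [DecidableEq A]

omit [Nonempty A] [Fintype A] in
-- The temporal difference is evaluated at the fixed coordinate `y`, not at the visited pair `x`;
-- the visited pair then enters only through an indicator, to which mixing applies.
lemma MDP.noise_apply (d Q : S × A → ℝ) (x : S × A) (s' : S) (y : S × A) :
    M.noise d Q x s' y = (if x = y then 1 else 0) * M.tdError Q y s' - d y * M.residual Q y := by
  simp only [MDP.noise, MDP.sampleDrift, MDP.meanDrift, Pi.sub_apply, Pi.single_apply, eq_comm]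
  split_ifs with h
  · subst h
    simp [MDP.tdError, MDP.residual]
  · simp [MDP.residual]

omit [Nonempty A] [DecidableEq S] [DecidableEq A] [Fintype S] [Fintype A] in
lemma abs_mul_sub_mul_le {c e a b K : ℝ} (hc : |c| ≤ 1) (he : |e| ≤ 1) (ha : |a| ≤ K)
    (hb : |b| ≤ K) : |c * a - e * b| ≤ 2 * K := by
  have h1 : |c * a| ≤ 1 * K := by
    rw [abs_mul]
    exact mul_le_mul hc ha (abs_nonneg _) zero_le_one
  have h2 : |e * b| ≤ 1 * K := by
    rw [abs_mul]
    exact mul_le_mul he hb (abs_nonneg _) zero_le_one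
  have := abs_sub (c * a) (e * b)
  linarith

lemma MDP.norm_noise_le (hr : ∀ s a s', |M.r s a s'| ≤ 1) {d Q : S × A → ℝ}
    (hd : ∀ x, |d x| ≤ 1) (hQ : ‖Q‖ ≤ 1 / (1 - M.γ)) (x : S × A) (s' : S) :
    ‖M.noise d Q x s'‖ ≤ 4 / (1 - M.γ) := by
  have h0 : 0 < 1 - M.γ := sub_pos.2 M.γ_lt_one
  refine (pi_norm_le_iff_of_nonneg (by positivity)).2 fun y => ?_
  rw [Real.norm_eq_abs, M.noise_apply]
  refine (abs_mul_sub_mul_le ?_ (hd y) (M.abs_tdError_le hr hQ y s')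
    (M.abs_residual_le hr hQ y)).trans (le_of_eq (by ring))
  split_ifs <;> simp

lemma MDP.abs_noise_sub_le {d : S × A → ℝ} (hd : ∀ x, |d x| ≤ 1) (Q Q' : S × A → ℝ)
    (x : S × A) (s' : S) (y : S × A) :
    |M.noise d Q x s' y - M.noise d Q' x s' y| ≤ 4 * ‖Q - Q'‖ := by
  have e : M.noise d Q x s' y - M.noise d Q' x s' y
      = (if x = y then 1 else 0) * (M.tdError Q y s' - M.tdError Q' y s')
        - d y * (M.residual Q y - M.residual Q' y) := by
    rw [M.noise_apply, M.noise_apply]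
    ring
  rw [e]
  refine (abs_mul_sub_mul_le ?_ (hd y) (M.abs_tdError_sub_le Q Q' y s')
    (M.abs_residual_sub_le Q Q' y)).trans (le_of_eq (by ring))
  split_ifs <;> simp

omit [Nonempty A] [Fintype A] in
-- The mean drift cancels against the noise, leaving the usual asynchronous update of one
-- coordinate.
lemma MDP.qIter_succ (d : S × A → ℝ) (α : ℕ → ℝ) (Q₀ : S × A → ℝ) (z : ℕ → S × A) (k : ℕ) :
    M.qIter d α Q₀ z (k + 1) = M.qIter d α Q₀ z k
      + α k • Pi.single (z k) (M.tdError (M.qIter d α Q₀ z k) (z k) (z (k + 1)).1) := by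
  simp only [MDP.qIter, MDP.noise, MDP.sampleDrift, MDP.tdError]
  congr 2
  abel

/-- The updated coordinate is a convex combination of its old value and a target of size at most `1
+ γ / (1 - γ) = 1 / (1 - γ)`. -/
lemma MDP.norm_qIter_le (hr : ∀ s a s', |M.r s a s'| ≤ 1) (d : S × A → ℝ) {α : ℕ → ℝ}
    (hα0 : ∀ k, 0 ≤ α k) (hα1 : ∀ k, α k ≤ 1) {Q₀ : S × A → ℝ} (hQ₀ : ‖Q₀‖ ≤ 1)
    (z : ℕ → S × A) (k : ℕ) : ‖M.qIter d α Q₀ z k‖ ≤ 1 / (1 - M.γ) := by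
  have h0 : 0 < 1 - M.γ := sub_pos.2 M.γ_lt_one
  induction k with
  | zero =>
    refine hQ₀.trans ?_
    rw [le_div_iff₀ h0]
    linarith [M.γ_nonneg]
  | succ k ih =>
    rw [M.qIter_succ]
    set Q := M.qIter d α Q₀ z k
    refine (pi_norm_le_iff_of_nonneg (by positivity)).2 fun y => ?_
    have hy := (norm_le_pi_norm Q y).trans ih
    simp only [Pi.add_apply, Pi.smul_apply, Pi.single_apply, smul_eq_mul]
    split_ifs with h
    · subst h
      have h1 := hr (z k).1 (z k).2 (z (k + 1)).1
      have h2 : |M.γ * ⨆ u, Q ((z (k + 1)).1, u)| ≤ M.γ * (1 / (1 - M.γ)) := by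
        rw [abs_mul, abs_of_nonneg M.γ_nonneg]
        exact mul_le_mul_of_nonneg_left ((abs_iSup_le Q _).trans ih) M.γ_nonneg
      have e : 1 + M.γ * (1 / (1 - M.γ)) = 1 / (1 - M.γ) := by
        field_simp
        ring
      set V := M.γ * ⨆ u, Q ((z (k + 1)).1, u) with hV
      have e2 : Q (z k) + α k * M.tdError Q (z k) (z (k + 1)).1
          = (1 - α k) * Q (z k) + α k * (M.r (z k).1 (z k).2 (z (k + 1)).1 + V) := by
        rw [MDP.tdError, hV]
        ring
      have h3 : |M.r (z k).1 (z k).2 (z (k + 1)).1 + V| ≤ 1 / (1 - M.γ) := by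
        rw [← e]
        exact (abs_add_le _ _).trans (add_le_add h1 h2)
      rw [e2, Real.norm_eq_abs]
      refine (abs_add_le _ _).trans ?_
      rw [abs_mul, abs_mul, abs_of_nonneg (hα0 k), abs_of_nonneg (sub_nonneg.2 (hα1 k))]
      rw [Real.norm_eq_abs] at hy
      have h4 := mul_le_mul_of_nonneg_left hy (sub_nonneg.2 (hα1 k))
      have h5 := mul_le_mul_of_nonneg_left h3 (hα0 k)
      linarith
    · simpa using hy

/-- The iterates move slowly. -/
lemma MDP.norm_qIter_sub_le (hr : ∀ s a s', |M.r s a s'| ≤ 1) (d : S × A → ℝ) {α : ℕ → ℝ}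
    (hα0 : ∀ k, 0 ≤ α k) (hα1 : ∀ k, α k ≤ 1) (hα : Antitone α) {Q₀ : S × A → ℝ}
    (hQ₀ : ‖Q₀‖ ≤ 1) (z : ℕ → S × A) (p t : ℕ) :
    ‖M.qIter d α Q₀ z (p + t) - M.qIter d α Q₀ z p‖ ≤ t * (α p * (2 / (1 - M.γ))) := by
  have h0 : 0 < 1 - M.γ := sub_pos.2 M.γ_lt_one
  induction t with
  | zero => simp
  | succ t ih =>
    rw [← add_assoc, M.qIter_succ, add_sub_right_comm]
    refine (norm_add_le _ _).trans ?_
    have h1 : ‖α (p + t) • (Pi.single (z (p + t)) (M.tdError (M.qIter d α Q₀ z (p + t))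
        (z (p + t)) (z (p + t + 1)).1) : S × A → ℝ)‖ ≤ α p * (2 / (1 - M.γ)) := by
      rw [norm_smul, Pi.norm_single, Real.norm_eq_abs, Real.norm_eq_abs, abs_of_nonneg (hα0 _)]
      exact mul_le_mul (hα (Nat.le_add_right p t))
        (M.abs_tdError_le hr (M.norm_qIter_le hr d hα0 hα1 hQ₀ z _) _ _) (abs_nonneg _) (hα0 p)
    push_cast
    linarith

omit [Nonempty A] [Fintype A] in
lemma MDP.dependsOn_qIter (d : S × A → ℝ) (α : ℕ → ℝ) (Q₀ : S × A → ℝ) (k : ℕ) :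
    DependsOn (fun z => M.qIter d α Q₀ z k) (Set.Iic k) := by
  induction k with
  | zero => exact fun _ _ _ => rfl
  | succ k ih =>
    intro z z' h
    have h1 := dependsOn_mono ih (Nat.le_succ k) h
    simp only at h1 ⊢
    rw [M.qIter_succ, M.qIter_succ, h1, h k (Nat.le_succ k), h (k + 1) (Set.mem_Iic.2 le_rfl)]

omit [Nonempty A] in
/-- `I + a T` contracts the supremum norm by the factor `1 - a (1 - γ) d_min`. -/
lemma MDP.norm_one_add_T_mulVec_le {d : S × A → ℝ} (hd : ∀ x, d x ≤ 1) (hd0 : ∀ x, 0 ≤ d x)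
    {dmin : ℝ} (hdm : ∀ x, dmin ≤ d x) {a : ℝ} (ha0 : 0 ≤ a) (ha1 : a ≤ 1)
    (π : S → A) (v : S × A → ℝ) :
    ‖(1 + a • M.T d π).mulVec v‖ ≤ (1 - a * ((1 - M.γ) * dmin)) * ‖v‖ := by
  have hγ := sub_pos.2 M.γ_lt_one
  have key : ∀ x, ‖(1 + a • M.T d π).mulVec v x‖ ≤ (1 - a * ((1 - M.γ) * dmin)) * ‖v‖ := by
    intro x
    have e0 : (M.policyMatrix π).mulVec v x = ∑ s', M.P x.1 x.2 s' * v (s', π s') := by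
      simp only [Matrix.mulVec, dotProduct, MDP.policyMatrix]
      rw [Fintype.sum_prod_type]
      refine Finset.sum_congr rfl fun s' _ => ?_
      simp
    -- Weight `1 - a * d x` stays on `v x`, and weight `a * d x` goes to `γ` times an average of
    -- entries of `v`; the loss is `a * d x * (1 - γ)`.
    have e : (1 + a • M.T d π).mulVec v x
        = (1 - a * d x) * v x + a * d x * (M.γ * ∑ s', M.P x.1 x.2 s' * v (s', π s')) := by
      rw [← e0, MDP.T, Matrix.add_mulVec, Matrix.smul_mulVec, Matrix.sub_mulVec,
        Matrix.smul_mulVec, ← Matrix.mulVec_mulVec, Matrix.one_mulVec]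
      simp only [Pi.add_apply, Pi.smul_apply, Pi.sub_apply, Matrix.mulVec_diagonal, smul_eq_mul]
      ring
    have h1 : |M.γ * ∑ s', M.P x.1 x.2 s' * v (s', π s')| ≤ M.γ * ‖v‖ := by
      rw [abs_mul, abs_of_nonneg M.γ_nonneg]
      exact mul_le_mul_of_nonneg_left
        (M.abs_sum_P_mul_le _ _ fun s' => norm_le_pi_norm v _) M.γ_nonneg
    have h2 : |v x| ≤ ‖v‖ := norm_le_pi_norm v x
    have hx1 : 0 ≤ 1 - a * d x := sub_nonneg.2 (mul_le_one₀ ha1 (hd0 x) (hd x))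
    have hx0 : 0 ≤ a * d x := mul_nonneg ha0 (hd0 x)
    rw [e, Real.norm_eq_abs]
    calc _ ≤ (1 - a * d x) * ‖v‖ + a * d x * (M.γ * ‖v‖) := by
          refine (abs_add_le _ _).trans ?_
          rw [abs_mul, abs_mul (a * d x), abs_of_nonneg hx0, abs_of_nonneg hx1]
          exact add_le_add (mul_le_mul_of_nonneg_left h2 hx1) (mul_le_mul_of_nonneg_left h1 hx0)
      _ = (1 - a * ((1 - M.γ) * d x)) * ‖v‖ := by ring
      _ ≤ _ := by
        have := mul_le_mul_of_nonneg_left (mul_le_mul_of_nonneg_left (hdm x) hγ.le) ha0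
        exact mul_le_mul_of_nonneg_right (by linarith) (norm_nonneg _)
  -- With no coordinates `dmin` is unconstrained and the factor could be negative, so this case is
  -- separate.
  rcases isEmpty_or_nonempty (S × A) with h | h
  · have hv : ‖v‖ = 0 := by
      rw [Subsingleton.elim v 0, norm_zero]
    rw [hv, mul_zero, Subsingleton.elim ((1 + a • M.T d π).mulVec v) 0, norm_zero]
  · exact (pi_norm_le_iff_of_nonempty _).2 key

/-- The noise along a trajectory. -/
noncomputable def MDP.noiseAt (d : S × A → ℝ) (α : ℕ → ℝ) (Q₀ : S × A → ℝ) (z : ℕ → S × A)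
    (i : ℕ) : S × A → ℝ :=
  M.noise d (M.qIter d α Q₀ z i) (z i) (z (i + 1)).1

omit [Nonempty A] [Fintype A] in
-- The horizon is `i + 1` rather than `i` because the noise involves the next state.
lemma MDP.dependsOn_noiseAt (d : S × A → ℝ) (α : ℕ → ℝ) (Q₀ : S × A → ℝ) (i : ℕ) :
    DependsOn (fun z => M.noiseAt d α Q₀ z i) (Set.Iic (i + 1)) := by
  intro z z' h
  have h1 := dependsOn_mono (M.dependsOn_qIter d α Q₀ i) (Nat.le_succ i) h
  simp only [MDP.noiseAt] at h1 ⊢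
  rw [h1, h i (Nat.le_succ i), h (i + 1) (Set.mem_Iic.2 le_rfl)]

omit [Nonempty A] in
lemma MDP.lowerIter_sub_optQ (d : S × A → ℝ) (α : ℕ → ℝ) (π : S → A) (Q₀ QL₀ : S × A → ℝ)
    (z : ℕ → S × A) (k : ℕ) :
    M.lowerIter d α π Q₀ QL₀ z k - M.optQ
      = (transition (fun k => 1 + α k • M.T d π) 0 k).mulVec (QL₀ - M.optQ)
        + ∑ i ∈ Finset.range k, α i •
          (transition (fun k => 1 + α k • M.T d π) (i + 1) k).mulVec (M.noiseAt d α Q₀ z i) := by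
  have := eq_transition_add_sum (fun k => 1 + α k • M.T d π)
    (fun k => M.lowerIter d α π Q₀ QL₀ z k - M.optQ) (fun i => α i • M.noiseAt d α Q₀ z i)
    (fun k => by
      simp only [MDP.lowerIter, MDP.noiseAt]
      abel) k
  simp only [Matrix.mulVec_smul] at this
  exact this

end Bounds

/-! ### Second moments of weakly correlated sums. -/

section SecondMoment

variable {Ω X : Type*} [Fintype X] [MeasurableSpace Ω] {μ : Measure Ω} [IsProbabilityMeasure μ]
  {K : Matrix X X ℝ} {Z : ℕ → Ω → X}

omit [Fintype X] in
lemma dependsOn_finsetSum {ι : Type*} {F : ι → (ℕ → X) → ℝ} {s : Set ℕ} (t : Finset ι)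
    (hF : ∀ i ∈ t, DependsOn (F i) s) : DependsOn (fun z => ∑ i ∈ t, F i z) s :=
  fun _ _ hz => Finset.sum_congr rfl fun i hi => hF i hi hz

lemma abs_integral_le_of_abs_le {f : Ω → ℝ} {b : ℝ}
    (h : ∀ ω, |f ω| ≤ b) : |∫ ω, f ω ∂μ| ≤ b := by
  simpa using norm_integral_le_of_norm_le_const (μ := μ) (f := f) (Eventually.of_forall h)

/-- A second moment bound for sums of terms that are almost uncorrelated at lag `τ`. -/
lemma IsMarkovChain.integral_sq_sum_le (h : IsMarkovChain μ K Z) {U : ℕ → (ℕ → X) → ℝ}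
    (hU : ∀ i, DependsOn (U i) (Set.Iic (i + 1))) (k τ : ℕ) {c s e : ℝ} (hc0 : 0 ≤ c)
    (he0 : 0 ≤ e) (hc : ∀ i < k, ∀ z, |U i z| ≤ c)
    (hs : ∀ i ≤ k, ∀ z, |∑ j ∈ Finset.range i, U j z| ≤ s)
    (he : ∀ i < k, 2 * τ ≤ i →
      |∫ ω, (∑ j ∈ Finset.range (i - τ), U j (fun l => Z l ω)) * U i (fun l => Z l ω) ∂μ| ≤ e) :
    ∫ ω, (∑ i ∈ Finset.range k, U i (fun l => Z l ω)) ^ 2 ∂μ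
      ≤ k * ((1 + 2 * τ) * c ^ 2) + 4 * τ * (c * s) + 2 * k * e := by
  set T : ℕ → (ℕ → X) → ℝ := fun i z => ∑ j ∈ Finset.range i, U j z with hT
  have hTd : ∀ i, DependsOn (T i) (Set.Iic i) := fun i =>
    dependsOn_finsetSum _ fun j hj => dependsOn_mono (hU j) (Finset.mem_range.1 hj)
  have hs0 : 0 ≤ s := (abs_nonneg _).trans (hs 0 (Nat.zero_le _) (fun l => Z l
    (μ.nonempty_of_neZero).some))
  have key : ∀ i ≤ k, ∫ ω, T i (fun l => Z l ω) ^ 2 ∂μ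
      ≤ i * ((1 + 2 * τ) * c ^ 2) + (min i (2 * τ) : ℕ) * (2 * (c * s)) + 2 * i * e := by
    intro i hi
    induction i with
    | zero => simp [hT]
    | succ i ih =>
      have ih' := ih (Nat.le_of_succ_le hi)
      have hik : i < k := hi
      have d1 : DependsOn (fun z => T i z ^ 2) (Set.Iic i) := fun _ _ hz =>
        congrArg (· ^ 2) (hTd i hz)
      have I1 := h.integrable d1
      have hcc : ∀ z, U i z ^ 2 ≤ c ^ 2 := fun z => by
        rw [← sq_abs]
        exact pow_le_pow_left₀ (abs_nonneg _) (hc i hik z) 2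
      have hτ0 : (0 : ℝ) ≤ τ := Nat.cast_nonneg τ
      rcases Nat.lt_or_ge i (2 * τ) with hlt | hge
      -- For the first `2 * τ` indices the cross term is bounded deterministically by `c * s`. The
      -- cutoff is `2 * τ`, not `τ`, so that later `α (i - τ)` is at most twice `α i`.
      · have hmin : min (i + 1) (2 * τ) = min i (2 * τ) + 1 := by omega
        have hp : ∀ ω, T (i + 1) (fun l => Z l ω) ^ 2
            ≤ T i (fun l => Z l ω) ^ 2 + (c ^ 2 + 2 * (c * s)) := by
          intro ω
          set z : ℕ → X := fun l => Z l ω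
          have e1 : T (i + 1) z = T i z + U i z := Finset.sum_range_succ _ _
          have e2 : |U i z * T i z| ≤ c * s := by
            rw [abs_mul]
            exact mul_le_mul (hc i hik z) (hs i hik.le z) (abs_nonneg _) hc0
          have := le_abs_self (U i z * T i z)
          rw [e1]
          nlinarith [hcc z]
        have := integral_mono (h.integrable (F := fun z => T (i + 1) z ^ 2) (fun _ _ hz =>
          congrArg (· ^ 2) (hTd (i + 1) hz))) (I1.add (integrable_const (c ^ 2 + 2 * (c * s)))) hp
        simp only [Pi.add_apply] at this
        rw [integral_add I1 (integrable_const _)] at this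
        simp only [integral_const, probReal_univ, one_smul] at this
        rw [hmin, Nat.cast_succ, Nat.cast_succ]
        nlinarith [mul_nonneg hτ0 (sq_nonneg c)]
      -- The cross term is split at time `i - τ`: the last `τ` summands cost `2 * τ * c ^ 2`, and
      -- the older ones are covered by the correlation bound `e`.
      · have hmin : min (i + 1) (2 * τ) = min i (2 * τ) := by omega
        have d3 : DependsOn (fun z => T (i - τ) z * U i z) (Set.Iic (i + 1)) :=
          dependsOn_mul (dependsOn_mono (hTd _) (by omega)) (hU i)
        have I3 := h.integrable d3
        have I12 : Integrable (fun ω => T i (fun l => Z l ω) ^ 2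
            + 2 * (T (i - τ) (fun l => Z l ω) * U i (fun l => Z l ω))) μ :=
          I1.add (I3.const_mul 2)
        have hp : ∀ ω, T (i + 1) (fun l => Z l ω) ^ 2
            ≤ T i (fun l => Z l ω) ^ 2 + 2 * (T (i - τ) (fun l => Z l ω) * U i (fun l => Z l ω))
              + (1 + 2 * τ) * c ^ 2 := by
          intro ω
          set z : ℕ → X := fun l => Z l ω
          have e1 : T (i + 1) z = T i z + U i z := Finset.sum_range_succ _ _
          have e3 : |T i z - T (i - τ) z| ≤ τ * c := by
            have e4 : T i z - T (i - τ) z = ∑ j ∈ Finset.Ico (i - τ) i, U j z :=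
              (Finset.sum_Ico_eq_sub _ (Nat.sub_le i τ)).symm
            rw [e4]
            refine (Finset.abs_sum_le_sum_abs _ _).trans ?_
            refine (Finset.sum_le_card_nsmul _ _ c fun j hj =>
              hc j ((Finset.mem_Ico.1 hj).2.trans hik) z).trans (le_of_eq ?_)
            rw [Nat.card_Ico, nsmul_eq_mul, Nat.sub_sub_self (by omega)]
          have e2 : |U i z * (T i z - T (i - τ) z)| ≤ c * (τ * c) := by
            rw [abs_mul]
            exact mul_le_mul (hc i hik z) e3 (abs_nonneg _) hc0
          have := le_abs_self (U i z * (T i z - T (i - τ) z))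
          rw [e1]
          nlinarith [hcc z]
        have := integral_mono (h.integrable (F := fun z => T (i + 1) z ^ 2) (fun _ _ hz =>
          congrArg (· ^ 2) (hTd (i + 1) hz)))
          (I12.add (integrable_const ((1 + 2 * τ) * c ^ 2))) hp
        simp only [Pi.add_apply] at this
        rw [integral_add I12 (integrable_const _), integral_add I1 (I3.const_mul 2), integral_const_mul] at this
        simp only [integral_const, probReal_univ, one_smul] at this
        have h3 := (le_abs_self _).trans (he i hik hge)
        rw [hmin, Nat.cast_succ]
        linarith
  refine (key k le_rfl).trans ?_
  have h1 : ((min k (2 * τ) : ℕ) : ℝ) ≤ 2 * τ := by exact_mod_cast min_le_right k (2 * τ)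
  have := mul_le_mul_of_nonneg_right h1 (mul_nonneg zero_le_two (mul_nonneg hc0 hs0))
  linarith

variable [DecidableEq X]

/-- The one-step Markov property, for a function of the past and of the next state. -/
lemma IsMarkovChain.integral_next (h : IsMarkovChain μ K Z) {j : ℕ} {G : (ℕ → X) → X → ℝ}
    (hG : ∀ w, DependsOn (fun z => G z w) (Set.Iic j)) :
    ∫ ω, G (fun i => Z i ω) (Z (j + 1) ω) ∂μ
      = ∫ ω, ∑ w, K (Z j ω) w * G (fun i => Z i ω) w ∂μ := by
  have e1 : ∀ ω, G (fun i => Z i ω) (Z (j + 1) ω)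
      = ∑ w, G (fun i => Z i ω) w * (if Z (j + 1) ω = w then 1 else 0) := fun ω => by simp
  simp_rw [e1]
  rw [integral_finsetSum, integral_finsetSum]
  · refine Finset.sum_congr rfl fun w _ => ?_
    rw [h.integral_mul_step (hG w) w]
    simp_rw [mul_comm]
  · exact fun w _ => h.integrable (dependsOn_mul (dependsOn_coord le_rfl fun x => K x w) (hG w))
  · exact fun w _ => h.integrable (dependsOn_mul (dependsOn_mono (hG w) (Nat.le_succ j))
      (dependsOn_coord le_rfl fun x => if x = w then (1 : ℝ) else 0))

end SecondMoment

/-! ### Correlation of the noise with the past. -/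

section Noise

variable {S A Ω : Type*} [Fintype S] [Fintype A] [DecidableEq S] [DecidableEq A]
  [MeasurableSpace Ω] {μ : Measure Ω} [IsProbabilityMeasure μ] {M : MDP S A} {β : S → A → ℝ}
  {Z : ℕ → Ω → S × A}

omit [DecidableEq S] [DecidableEq A] in
lemma MDP.sum_chain_mul (hβ : ∀ s, β s ∈ stdSimplex ℝ A) (x : S × A) (f : S → ℝ) :
    ∑ w, M.chain β x w * f w.1 = ∑ s', M.P x.1 x.2 s' * f s' := by
  rw [Fintype.sum_prod_type]
  refine Finset.sum_congr rfl fun s' _ => ?_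
  simp only [MDP.chain]
  rw [← Finset.sum_mul, ← Finset.mul_sum, (hβ s').2, mul_one]

lemma MDP.chain_mem_rowStochastic (hβ : ∀ s, β s ∈ stdSimplex ℝ A) :
    M.chain β ∈ Matrix.rowStochastic ℝ (S × A) := by
  rw [Matrix.mem_rowStochastic_iff_sum]
  refine ⟨fun x y => mul_nonneg (M.P_nonneg _ _ _) ((hβ _).1 _), fun x => ?_⟩
  simpa [M.sum_P] using M.sum_chain_mul hβ x fun _ => 1

/-- The mean of the noise at a frozen iterate, given the states up to time `p`. -/
lemma integral_mul_noise (h : IsMarkovChain μ (M.chain β) Z) (hβ : ∀ s, β s ∈ stdSimplex ℝ A)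
    (d : S × A → ℝ) {p : ℕ} {F : (ℕ → S × A) → ℝ} (hF : DependsOn F (Set.Iic p))
    {Q : (ℕ → S × A) → S × A → ℝ} (hQ : DependsOn Q (Set.Iic p)) (t : ℕ) (y : S × A) :
    ∫ ω, F (fun i => Z i ω)
        * M.noise d (Q fun i => Z i ω) (Z (p + t) ω) (Z (p + t + 1) ω).1 y ∂μ
      = ∫ ω, F (fun i => Z i ω)
        * (((M.chain β ^ t) (Z p ω) y - d y) * M.residual (Q fun i => Z i ω) y) ∂μ := by
  have hQr : DependsOn (fun z => M.residual (Q z) y) (Set.Iic p) := fun _ _ hz =>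
    congrArg (fun q => M.residual q y) (hQ hz)
  have hQt : ∀ s', DependsOn (fun z => M.tdError (Q z) y s') (Set.Iic p) := fun s' _ _ hz =>
    congrArg (fun q => M.tdError q y s') (hQ hz)
  have hp : p ≤ p + t := Nat.le_add_right p t
  set G : (ℕ → S × A) → S × A → ℝ := fun z w =>
    F z * (if z (p + t) = y then 1 else 0) * M.tdError (Q z) y w.1 with hGdef
  have hind : DependsOn (fun z : ℕ → S × A => if z (p + t) = y then (1 : ℝ) else 0)
      (Set.Iic (p + t)) := dependsOn_coord le_rfl fun x => if x = y then (1 : ℝ) else 0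
  have hG : ∀ w, DependsOn (fun z => G z w) (Set.Iic (p + t)) := fun w =>
    dependsOn_mul (dependsOn_mul (dependsOn_mono hF hp) hind) (dependsOn_mono (hQt w.1) hp)
  have h1 := h.integral_next hG
  -- Averaging over the next state turns the temporal difference into the residual, which is known
  -- at time `p`; only the indicator of `y` remains for the `t`-step Markov property.
  have e1 : ∀ ω, ∑ w, M.chain β (Z (p + t) ω) w * G (fun i => Z i ω) w
      = F (fun i => Z i ω) * M.residual (Q fun i => Z i ω) y
        * (if Z (p + t) ω = y then 1 else 0) := by
    intro ω
    by_cases hy : Z (p + t) ω = y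
    · simp only [hGdef, hy, if_true, mul_one]
      rw [← M.sum_P_mul_tdError, ← M.sum_chain_mul hβ y, Finset.mul_sum]
      exact Finset.sum_congr rfl fun w _ => by ring
    · simp [hGdef, hy]
  simp_rw [e1] at h1
  rw [h.integral_mul_pow (F := fun z => F z * M.residual (Q z) y) (dependsOn_mul hF hQr) t y]
    at h1
  have hR : DependsOn (fun z => F z * (d y * M.residual (Q z) y)) (Set.Iic p) :=
    dependsOn_mul hF fun _ _ hz => congrArg (d y * ·) (hQr hz)
  have IR := h.integrable hR
  have IG : Integrable (fun ω => G (fun i => Z i ω) (Z (p + t + 1) ω)) μ :=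
    h.integrable (F := fun z => G z (z (p + t + 1))) (j := p + t + 1) fun z z' hz => by
      have := dependsOn_mono (hG (z' (p + t + 1))) (Nat.le_succ (p + t)) hz
      simp only at this ⊢
      rw [hz (p + t + 1) (Set.mem_Iic.2 le_rfl), this]
  have IK : Integrable (fun ω => F (fun i => Z i ω) * M.residual (Q fun i => Z i ω) y
      * (M.chain β ^ t) (Z p ω) y) μ :=
    h.integrable (dependsOn_mul (dependsOn_mul hF hQr)
      (dependsOn_coord le_rfl fun x => (M.chain β ^ t) x y))
  calc _ = ∫ ω, (G (fun i => Z i ω) (Z (p + t + 1) ω)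
        - F (fun i => Z i ω) * (d y * M.residual (Q fun i => Z i ω) y)) ∂μ := by
        refine integral_congr_ae (Eventually.of_forall fun ω => ?_)
        simp only [M.noise_apply, hGdef]
        ring
    _ = ∫ ω, (F (fun i => Z i ω) * M.residual (Q fun i => Z i ω) y * (M.chain β ^ t) (Z p ω) y
        - F (fun i => Z i ω) * (d y * M.residual (Q fun i => Z i ω) y)) ∂μ := by
        rw [integral_sub IG IR, integral_sub IK IR, h1]
    _ = _ := by
        refine integral_congr_ae (Eventually.of_forall fun ω => ?_)
        simp only
        ring

/-- The noise is almost uncorrelated with the past at lag `t`. -/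
lemma abs_integral_mul_noiseAt_le [Nonempty A] (h : IsMarkovChain μ (M.chain β) Z)
    (hβ : ∀ s, β s ∈ stdSimplex ℝ A) (hr : ∀ s a s', |M.r s a s'| ≤ 1) {d : S × A → ℝ}
    (hd : ∀ x, |d x| ≤ 1) {α : ℕ → ℝ} (hα0 : ∀ k, 0 ≤ α k) (hα1 : ∀ k, α k ≤ 1)
    (hα : Antitone α) {Q₀ : S × A → ℝ} (hQ₀ : ‖Q₀‖ ≤ 1) {p t : ℕ} {F : (ℕ → S × A) → ℝ}
    (hF : DependsOn F (Set.Iic p)) {b ε : ℝ} (hb : ∀ z, |F z| ≤ b)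
    (hε : ∀ x y, |(M.chain β ^ t) x y - d y| ≤ ε) (y : S × A) :
    |∫ ω, F (fun i => Z i ω) * M.noiseAt d α Q₀ (fun i => Z i ω) (p + t) y ∂μ|
      ≤ b * ((2 * ε + 8 * (t * α p)) / (1 - M.γ)) := by
  have h0 : 0 < 1 - M.γ := sub_pos.2 M.γ_lt_one
  have hb0 : 0 ≤ b := (abs_nonneg _).trans (hb fun _ => y)
  have hε0 : 0 ≤ ε := (abs_nonneg _).trans (hε y y)
  set Q : (ℕ → S × A) → S × A → ℝ := fun z => M.qIter d α Q₀ z p with hQdef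
  have hQ : DependsOn Q (Set.Iic p) := M.dependsOn_qIter d α Q₀ p
  have hQn : ∀ z, ‖Q z‖ ≤ 1 / (1 - M.γ) := fun z => M.norm_qIter_le hr d hα0 hα1 hQ₀ z p
  -- Noise with the iterate frozen at time `p`: mixing controls its correlation with `F` (`b1`), and
  -- Lipschitz dependence on the slowly moving iterate controls the freezing error (`b2`).
  set fr : (ℕ → S × A) → ℝ := fun z => M.noise d (Q z) (z (p + t)) (z (p + t + 1)).1 y
  have hfr : DependsOn fr (Set.Iic (p + t + 1)) := fun z z' hz => by
    have := dependsOn_mono hQ (show p ≤ p + t + 1 by omega) hz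
    simp only [fr]
    rw [this, hz (p + t) (Nat.le_succ _), hz (p + t + 1) (Set.mem_Iic.2 le_rfl)]
  have hno : DependsOn (fun z => M.noiseAt d α Q₀ z (p + t) y) (Set.Iic (p + t + 1)) :=
    fun _ _ hz => congrFun (M.dependsOn_noiseAt d α Q₀ (p + t) hz) y
  have hF' := dependsOn_mono hF (show p ≤ p + t + 1 by omega)
  have I1 := h.integrable (dependsOn_mul hF' hfr)
  have I2 := h.integrable (dependsOn_mul hF' hno)
  have b1 : |∫ ω, F (fun i => Z i ω) * fr (fun i => Z i ω) ∂μ|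
      ≤ b * (ε * (2 / (1 - M.γ))) := by
    rw [integral_mul_noise h hβ d hF hQ t y]
    refine abs_integral_le_of_abs_le fun ω => ?_
    rw [abs_mul, abs_mul]
    exact mul_le_mul (hb _) (mul_le_mul (hε _ _) (M.abs_residual_le hr (hQn _) y)
      (abs_nonneg _) hε0) (by positivity) hb0
  have b2 : |∫ ω, (F (fun i => Z i ω) * M.noiseAt d α Q₀ (fun i => Z i ω) (p + t) y
      - F (fun i => Z i ω) * fr (fun i => Z i ω)) ∂μ|
      ≤ b * (4 * (t * (α p * (2 / (1 - M.γ))))) := by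
    refine abs_integral_le_of_abs_le fun ω => ?_
    rw [← mul_sub, abs_mul]
    refine mul_le_mul (hb _) ((M.abs_noise_sub_le hd _ _ _ _ y).trans ?_) (abs_nonneg _) hb0
    exact mul_le_mul_of_nonneg_left
      (M.norm_qIter_sub_le hr d hα0 hα1 hα hQ₀ _ p t) (by norm_num)
  rw [integral_sub I2 I1] at b2
  have e : b * ((2 * ε + 8 * (t * α p)) / (1 - M.γ))
      = b * (ε * (2 / (1 - M.γ))) + b * (4 * (t * (α p * (2 / (1 - M.γ))))) := by
    ring
  rw [e]
  rw [abs_le] at *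
  constructor <;> linarith [b1.1, b1.2, b2.1, b2.2]

end Noise

/-! ### Step-size estimates. -/

section StepSize

variable {θ ξ : ℝ}

lemma stepSize_nonneg (hθ : 0 ≤ θ) (hξ : 0 < ξ) (k : ℕ) : 0 ≤ stepSize θ ξ k := by
  rw [stepSize]
  positivity

lemma stepSize_le_one (hξ : 0 < ξ) (h : θ ≤ ξ) (k : ℕ) : stepSize θ ξ k ≤ 1 := by
  have hk := Nat.cast_nonneg (α := ℝ) k
  rw [stepSize, div_le_one (by linarith)]
  linarith

lemma antitone_stepSize (hθ : 0 ≤ θ) (hξ : 0 < ξ) : Antitone (stepSize θ ξ) := fun i j hij => by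
  have : (i : ℝ) ≤ j := by exact_mod_cast hij
  exact div_le_div_of_nonneg_left hθ (by positivity) (by linarith)

/-- The denominator of the step-size cancels one of the two factors `i + ξ`; the `4` pays for
replacing `k + ξ - 1` by `k + ξ`, using `ξ ≥ 2`. -/
lemma stepSize_mul_sq_le (hθ : 0 ≤ θ) (hξ : 2 ≤ ξ) (i k : ℕ) :
    stepSize θ ξ i * (((i + 1 : ℕ) + ξ - 1) / (k + ξ - 1)) ^ 2
      ≤ 4 * θ * (i + ξ) / (k + ξ) ^ 2 := by
  have hi := Nat.cast_nonneg (α := ℝ) i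
  have hk := Nat.cast_nonneg (α := ℝ) k
  have h1 : (0 : ℝ) < i + ξ := by linarith
  have h2 : (0 : ℝ) < k + ξ - 1 := by linarith
  have h3 : (0 : ℝ) < k + ξ := by linarith
  have e : stepSize θ ξ i * (((i + 1 : ℕ) + ξ - 1) / (k + ξ - 1)) ^ 2
      = θ * (i + ξ) / (k + ξ - 1) ^ 2 := by
    rw [stepSize]
    push_cast
    rw [show (i + 1 + ξ - 1 : ℝ) = i + ξ by ring]
    field_simp
  rw [e, div_le_div_iff₀ (by positivity) (by positivity)]
  have h4 : (k + ξ) ^ 2 ≤ 4 * (k + ξ - 1) ^ 2 := by nlinarith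
  have := mul_le_mul_of_nonneg_left h4 (mul_nonneg hθ h1.le)
  linarith

lemma stepSize_sub_le (hθ : 0 ≤ θ) (hξ : 0 < ξ) {i τ : ℕ} (h : 2 * τ ≤ i) :
    stepSize θ ξ (i - τ) ≤ 2 * stepSize θ ξ i := by
  have hc : ((i - τ : ℕ) : ℝ) = i - τ := Nat.cast_sub (by omega)
  have h' : 2 * (τ : ℝ) ≤ i := by exact_mod_cast h
  have hτ := Nat.cast_nonneg (α := ℝ) τ
  rw [stepSize, stepSize, hc, ← mul_div_assoc, div_le_div_iff₀ (by linarith) (by linarith)]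
  nlinarith

end StepSize

/-! ### Error bound in terms of the step-size parameters. -/

section Main

variable {S A Ω : Type*} [Fintype S] [Fintype A] [DecidableEq S] [DecidableEq A]
  [MeasurableSpace Ω] {μ : Measure Ω} [IsProbabilityMeasure μ] {M : MDP S A} {β : S → A → ℝ}
  {Z : ℕ → Ω → S × A}

lemma MDP.norm_step_le {d : S × A → ℝ} (hd0 : ∀ x, 0 ≤ d x) (hd1 : ∀ x, d x ≤ 1) {dmin : ℝ}
    (hdm : ∀ x, dmin ≤ d x) {θ ξ : ℝ} (hθ : 2 ≤ θ) (hθh : 2 ≤ θ * ((1 - M.γ) * dmin))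
    (hξ : θ ≤ ξ) (π : S → A) (k : ℕ) (v : S × A → ℝ) :
    ‖(1 + stepSize θ ξ k • M.T d π).mulVec v‖ ≤ (1 - 2 / (k + ξ)) * ‖v‖ := by
  refine (M.norm_one_add_T_mulVec_le hd1 hd0 hdm (stepSize_nonneg (by linarith) (by linarith) k)
    (stepSize_le_one (by linarith) hξ k) π v).trans ?_
  refine mul_le_mul_of_nonneg_right (sub_le_sub_left ?_ 1) (norm_nonneg v)
  have hk := Nat.cast_nonneg (α := ℝ) k
  rw [stepSize, div_mul_eq_mul_div]
  exact div_le_div_of_nonneg_right hθh (by linarith)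

/-- Second moment of a coordinate of the accumulated noise. -/
lemma integral_sq_noise_sum_le [Nonempty A] (h : IsMarkovChain μ (M.chain β) Z)
    (hβ : ∀ s, β s ∈ stdSimplex ℝ A) (hr : ∀ s a s', |M.r s a s'| ≤ 1) {d : S × A → ℝ}
    (hd0 : ∀ x, 0 ≤ d x) (hd1 : ∀ x, d x ≤ 1) {dmin : ℝ} (hdm : ∀ x, dmin ≤ d x) {θ ξ : ℝ}
    (hθ : 2 ≤ θ) (hθh : 2 ≤ θ * ((1 - M.γ) * dmin)) (hξ : θ ≤ ξ) (π : S → A)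
    {Q₀ : S × A → ℝ} (hQ₀ : ‖Q₀‖ ≤ 1) (k τ : ℕ)
    (hτ : ∀ x y, |(M.chain β ^ τ) x y - d y| ≤ stepSize θ ξ k) (x : S × A) :
    ∫ ω, (∑ i ∈ Finset.range k, stepSize θ ξ i *
      (transition (fun k => 1 + stepSize θ ξ k • M.T d π) (i + 1) k).mulVec
        (M.noiseAt d (stepSize θ ξ) Q₀ (fun l => Z l ω) i) x) ^ 2 ∂μ
      ≤ 3600 * (τ + 1) * θ ^ 3 * (1 / (1 - M.γ)) ^ 2 / (k + ξ) := by
  set α := stepSize θ ξ with hαdef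
  set L : ℕ → Matrix (S × A) (S × A) ℝ := fun k => 1 + α k • M.T d π with hL
  set N : ℝ := k + ξ with hN
  set B : ℝ := 1 / (1 - M.γ) with hB
  have hγ : 0 < 1 - M.γ := sub_pos.2 M.γ_lt_one
  have hB0 : 0 < B := by positivity
  have hk0 := Nat.cast_nonneg (α := ℝ) k
  have hτ0 := Nat.cast_nonneg (α := ℝ) τ
  have hN0 : 0 < N := by linarith
  have hθ0 : (0 : ℝ) ≤ θ := by linarith
  have hξ0 : 0 < ξ := by linarith
  have hα0 := stepSize_nonneg hθ0 hξ0
  have hα1 := stepSize_le_one hξ0 hξ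
  have hαa := antitone_stepSize hθ0 hξ0
  have hdabs : ∀ x, |d x| ≤ 1 := fun x => by rw [abs_of_nonneg (hd0 x)]; exact hd1 x
  set U : ℕ → (ℕ → S × A) → ℝ := fun i z =>
    α i * (transition L (i + 1) k).mulVec (M.noiseAt d α Q₀ z i) x with hU
  have hUd : ∀ i, DependsOn (U i) (Set.Iic (i + 1)) := fun i _ _ hz =>
    congrArg (fun w => α i * (transition L (i + 1) k).mulVec w x)
      (M.dependsOn_noiseAt d α Q₀ i hz)
  -- the weight of the `i`-th noise vector
  have hweight : ∀ i < k, ∀ v : S × A → ℝ,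
      |α i * (transition L (i + 1) k).mulVec v x| ≤ 4 * θ * (i + ξ) / N ^ 2 * ‖v‖ := by
    intro i hi v
    rw [abs_mul, abs_of_nonneg (hα0 i)]
    have h1 := (norm_le_pi_norm _ x).trans (norm_transition_mulVec_le (hθ.trans hξ)
      (fun k v => M.norm_step_le hd0 hd1 hdm hθ hθh hξ π k v) (Nat.succ_le_of_lt hi) v)
    rw [Real.norm_eq_abs] at h1
    have h2 := mul_le_mul_of_nonneg_left h1 (hα0 i)
    rw [← mul_assoc] at h2
    exact h2.trans (mul_le_mul_of_nonneg_right (stepSize_mul_sq_le hθ0 (hθ.trans hξ) i k)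
      (norm_nonneg v))
  have hiN : ∀ i < k, (i : ℝ) + ξ ≤ N := fun i hi => by
    have : (i : ℝ) ≤ k := by exact_mod_cast hi.le
    linarith
  have hcoef : ∀ i < k, 4 * θ * (i + ξ) / N ^ 2 ≤ 4 * θ / N := by
    intro i hi
    rw [div_le_div_iff₀ (by positivity) hN0]
    have := mul_le_mul_of_nonneg_left (hiN i hi) (by positivity : 0 ≤ 4 * θ * N)
    linarith
  -- `c` is the maximal weight `4 * θ / N` times the noise bound `4 * B`; `s = N * c` bounds any
  -- partial sum, and `e` bounds the correlation at lag `τ`.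
  set c : ℝ := 16 * θ * B / N with hc
  set s : ℝ := 16 * θ * B with hs
  set e : ℝ := s * ((8 + 64 * τ) * θ ^ 2 * B / N ^ 2) with he
  have hs0 : 0 ≤ s := by positivity
  have hUc : ∀ i < k, ∀ z, |U i z| ≤ c := by
    intro i hi z
    have h1 : ‖M.noiseAt d α Q₀ z i‖ ≤ 4 / (1 - M.γ) :=
      M.norm_noise_le hr hdabs (M.norm_qIter_le hr d hα0 hα1 hQ₀ z i) _ _
    refine (hweight i hi _).trans
      ((mul_le_mul (hcoef i hi) h1 (norm_nonneg _) (by positivity)).trans (le_of_eq ?_))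
    rw [hc, hs, hB]
    ring
  have hUs : ∀ i ≤ k, ∀ z, |∑ j ∈ Finset.range i, U j z| ≤ s := by
    intro i hi z
    have hik : (i : ℝ) ≤ N := by
      have : (i : ℝ) ≤ k := by exact_mod_cast hi
      linarith
    calc _ ≤ ∑ j ∈ Finset.range i, |U j z| := Finset.abs_sum_le_sum_abs _ _
      _ ≤ ∑ _j ∈ Finset.range i, c :=
        Finset.sum_le_sum fun j hj => hUc j ((Finset.mem_range.1 hj).trans_le hi) z
      _ = i * c := by simp
      _ ≤ N * c := mul_le_mul_of_nonneg_right hik (by positivity)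
      _ = s := by
        rw [hc, hs]
        field_simp
  have hUe : ∀ i < k, 2 * τ ≤ i → |∫ ω, (∑ j ∈ Finset.range (i - τ), U j (fun l => Z l ω))
      * U i (fun l => Z l ω) ∂μ| ≤ e := by
    intro i hi hτi
    have hpi : i - τ + τ = i := by omega
    set F : (ℕ → S × A) → ℝ := fun z => ∑ j ∈ Finset.range (i - τ), U j z with hF
    have hFd : DependsOn F (Set.Iic (i - τ)) :=
      dependsOn_finsetSum _ fun j hj => dependsOn_mono (hUd j) (Finset.mem_range.1 hj)
    -- The transition matrix is deterministic, so it acts on the vector of correlations; its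
    -- sup-norm bound then applies without a dimension factor.
    set v : S × A → ℝ := fun y =>
      ∫ ω, F (fun l => Z l ω) * M.noiseAt d α Q₀ (fun l => Z l ω) i y ∂μ with hv
    have hvn : ‖v‖ ≤ s * ((2 * α k + 8 * (τ * α (i - τ))) / (1 - M.γ)) := by
      have := hα0 k
      have := hα0 (i - τ)
      refine (pi_norm_le_iff_of_nonneg (by positivity)).2 fun y => ?_
      have h1 := abs_integral_mul_noiseAt_le h hβ hr hdabs hα0 hα1 hαa hQ₀ hFd
        (hUs (i - τ) (by omega)) hτ y
      rwa [hpi] at h1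
    have hint : ∫ ω, F (fun l => Z l ω) * U i (fun l => Z l ω) ∂μ
        = α i * (transition L (i + 1) k).mulVec v x := by
      have e1 : ∀ ω, F (fun l => Z l ω) * U i (fun l => Z l ω)
          = ∑ y, α i * transition L (i + 1) k x y *
            (F (fun l => Z l ω) * M.noiseAt d α Q₀ (fun l => Z l ω) i y) := by
        intro ω
        simp only [hU, Matrix.mulVec, dotProduct, Finset.mul_sum]
        exact Finset.sum_congr rfl fun y _ => by ring
      simp_rw [e1]
      rw [integral_finsetSum]
      · simp only [Matrix.mulVec, dotProduct, Finset.mul_sum]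
        refine Finset.sum_congr rfl fun y _ => ?_
        rw [integral_const_mul, mul_assoc]
      · intro y _
        exact (h.integrable (dependsOn_mul (dependsOn_mono hFd (by omega : i - τ ≤ i + 1))
          fun _ _ hz => congrFun (M.dependsOn_noiseAt d α Q₀ i hz) y)).const_mul _
    rw [hint]
    refine (hweight i hi v).trans ?_
    have hi0 : (0 : ℝ) < i + ξ := by
      have := Nat.cast_nonneg (α := ℝ) i
      linarith
    have h1 : 8 * (τ * α (i - τ)) ≤ 8 * (τ * (2 * α i)) := by
      have := stepSize_sub_le hθ0 hξ0 hτi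
      gcongr
    have h2 : ‖v‖ ≤ s * ((2 * α k + 8 * (τ * (2 * α i))) / (1 - M.γ)) :=
      hvn.trans (mul_le_mul_of_nonneg_left
        (div_le_div_of_nonneg_right (by linarith) hγ.le) hs0)
    refine (mul_le_mul_of_nonneg_left h2 (by positivity)).trans ?_
    -- The factor `i + ξ` in the weight cancels the denominator of `α i`, which is why `hweight`
    -- keeps the dependence on `i`.
    have e2 : 4 * θ * (i + ξ) / N ^ 2 * (s * ((2 * α k + 8 * (τ * (2 * α i))) / (1 - M.γ)))
        = s * ((8 * ((i + ξ) / N) + 64 * τ) * θ ^ 2 * B / N ^ 2) := by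
      rw [hαdef, stepSize, stepSize, ← hN, hB]
      field_simp
      ring
    rw [e2, he]
    have h3 : ((i : ℝ) + ξ) / N ≤ 1 := (div_le_one hN0).2 (hiN i hi)
    gcongr
    linarith
  refine (h.integral_sq_sum_le hUd k τ (by positivity) (by positivity) hUc hUs hUe).trans ?_
  have hkN : (k : ℝ) ≤ N := by linarith
  calc k * ((1 + 2 * τ) * c ^ 2) + 4 * τ * (c * s) + 2 * k * e
      ≤ N * ((1 + 2 * τ) * c ^ 2) + 4 * τ * (c * s) + 2 * N * e := by
        have : 0 ≤ e := by positivity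
        gcongr
    _ = θ ^ 2 * B ^ 2 / N * ((256 + 1536 * τ) + (256 + 2048 * τ) * θ) := by
        rw [he, hc, hs]
        field_simp
        ring
    -- `θ ≥ 2` absorbs the terms without `θ`; `3600 = 60 ^ 2` is a generous constant with an integer
    -- root.
    _ ≤ θ ^ 2 * B ^ 2 / N * (3600 * (τ + 1) * θ) := by
        refine mul_le_mul_of_nonneg_left ?_ (by positivity)
        nlinarith [mul_nonneg hτ0 (sub_nonneg.2 hθ)]
    _ = _ := by ring

/-- The mean of the error of the lower comparison system, in terms of the step-size. -/
lemma integral_norm_lowerIter_le [Nonempty A] (h : IsMarkovChain μ (M.chain β) Z)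
    (hβ : ∀ s, β s ∈ stdSimplex ℝ A) (hr : ∀ s a s', |M.r s a s'| ≤ 1) {d : S × A → ℝ}
    (hd0 : ∀ x, 0 ≤ d x) (hd1 : ∀ x, d x ≤ 1) {dmin : ℝ} (hdm : ∀ x, dmin ≤ d x) {θ ξ : ℝ}
    (hθ : 2 ≤ θ) (hθh : 2 ≤ θ * ((1 - M.γ) * dmin)) (hξ : θ ≤ ξ) (π : S → A)
    {Q₀ : S × A → ℝ} (hQ₀ : ‖Q₀‖ ≤ 1) (QL₀ : S × A → ℝ) (k τ : ℕ)
    (hτ : ∀ x y, |(M.chain β ^ τ) x y - d y| ≤ stepSize θ ξ k) :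
    Integrable (fun ω => ‖M.lowerIter d (stepSize θ ξ) π Q₀ QL₀ (fun i => Z i ω) k - M.optQ‖) μ ∧
    ∫ ω, ‖M.lowerIter d (stepSize θ ξ) π Q₀ QL₀ (fun i => Z i ω) k - M.optQ‖ ∂μ
      ≤ Real.sqrt ξ / Real.sqrt (k + ξ) * norm2 (QL₀ - M.optQ)
        + Real.sqrt (Fintype.card (S × A)
          * (3600 * (τ + 1) * θ ^ 3 * (1 / (1 - M.γ)) ^ 2 / (k + ξ))) := by
  set α := stepSize θ ξ with hαdef
  set L : ℕ → Matrix (S × A) (S × A) ℝ := fun k => 1 + α k • M.T d π with hL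
  set w : (ℕ → S × A) → S × A → ℝ := fun z =>
    ∑ i ∈ Finset.range k, α i • (transition L (i + 1) k).mulVec (M.noiseAt d α Q₀ z i) with hw
  set v₀ : S × A → ℝ := (transition L 0 k).mulVec (QL₀ - M.optQ) with hv₀
  have hdec : ∀ z, M.lowerIter d α π Q₀ QL₀ z k - M.optQ = v₀ + w z := fun z =>
    M.lowerIter_sub_optQ d α π Q₀ QL₀ z k
  have hwd : DependsOn w (Set.Iic k) := fun z z' hz => by
    refine Finset.sum_congr rfl fun i hi => ?_
    have := dependsOn_mono (M.dependsOn_noiseAt d α Q₀ i) (Finset.mem_range.1 hi) hz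
    simp only at this
    rw [this]
  have hwx : ∀ z x, w z x = ∑ i ∈ Finset.range k, α i *
      (transition L (i + 1) k).mulVec (M.noiseAt d α Q₀ z i) x := fun z x => by
    simp [hw, Finset.sum_apply]
  have I0 : Integrable (fun ω => ‖v₀ + w (fun i => Z i ω)‖) μ :=
    h.integrable (F := fun z => ‖v₀ + w z‖) fun _ _ hz => congrArg (fun u => ‖v₀ + u‖) (hwd hz)
  have I1 : Integrable (fun ω => ‖w (fun i => Z i ω)‖) μ :=
    h.integrable (F := fun z => ‖w z‖) fun _ _ hz => congrArg (fun u => ‖u‖) (hwd hz)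
  have I2 : ∀ x, Integrable (fun ω => w (fun i => Z i ω) x ^ 2) μ := fun x =>
    h.integrable (F := fun z => w z x ^ 2) fun _ _ hz => congrArg (fun u => u x ^ 2) (hwd hz)
  simp_rw [hdec]
  refine ⟨I0, ?_⟩
  have hγ : 0 < 1 - M.γ := sub_pos.2 M.γ_lt_one
  have hk0 := Nat.cast_nonneg (α := ℝ) k
  have hξ2 : 2 ≤ ξ := hθ.trans hξ
  have hN0 : (0 : ℝ) < k + ξ := by linarith
  obtain ⟨x₀⟩ : Nonempty (S × A) := by
    obtain ⟨ω⟩ := μ.nonempty_of_neZero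
    exact ⟨Z 0 ω⟩
  have hcard : (0 : ℝ) < Fintype.card (S × A) := by
    exact_mod_cast Fintype.card_pos_iff.2 ⟨x₀⟩
  set V : ℝ := Fintype.card (S × A)
          * (3600 * (τ + 1) * θ ^ 3 * (1 / (1 - M.γ)) ^ 2 / (k + ξ)) with hV
  have hV0 : 0 < V := by positivity
  have hcoord : ∀ z x, w z x ^ 2 ≤ ∑ y, w z y ^ 2 := fun z x =>
    Finset.single_le_sum (f := fun y => w z y ^ 2) (fun _ _ => sq_nonneg _) (Finset.mem_univ x)
  have hnorm : ∀ u : S × A → ℝ, ‖u‖ ≤ norm2 u := fun u =>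
    (pi_norm_le_iff_of_nonneg (Real.sqrt_nonneg _)).2 fun x =>
      Real.abs_le_sqrt (Finset.single_le_sum (f := fun y => u y ^ 2)
        (fun _ _ => sq_nonneg _) (Finset.mem_univ x))
  -- the noise part
  have hpart2 : ∫ ω, ‖w (fun i => Z i ω)‖ ∂μ ≤ Real.sqrt V := by
    have ht : 0 < Real.sqrt V := Real.sqrt_pos.2 hV0
    -- AM-GM with parameter `√V` plays the role of Jensen's inequality and is linear in the second
    -- moment.
    have hp : ∀ ω, ‖w (fun i => Z i ω)‖
        ≤ (∑ y, w (fun i => Z i ω) y ^ 2) * (1 / (2 * Real.sqrt V)) + Real.sqrt V / 2 := by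
      intro ω
      have h1 := hnorm (w fun i => Z i ω)
      have h2 : norm2 (w fun i => Z i ω) ^ 2 = ∑ y, w (fun i => Z i ω) y ^ 2 :=
        Real.sq_sqrt (Finset.sum_nonneg fun _ _ => sq_nonneg _)
      rw [← h2]
      refine h1.trans ?_
      have h3 := sq_nonneg (norm2 (w fun i => Z i ω) - Real.sqrt V)
      rw [mul_one_div, div_add_div _ _ (by positivity) two_ne_zero, le_div_iff₀ (by positivity)]
      nlinarith
    have I3 : Integrable (fun ω => ∑ y, w (fun i => Z i ω) y ^ 2) μ :=
      integrable_finsetSum _ fun y _ => I2 y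
    have h1 := integral_mono I1 ((I3.mul_const _).add (integrable_const (Real.sqrt V / 2))) hp
    simp only [Pi.add_apply] at h1
    rw [integral_add (I3.mul_const _) (integrable_const _), integral_mul_const,
      integral_finsetSum _ fun y _ => I2 y] at h1
    simp only [integral_const, probReal_univ, one_smul] at h1
    have h2 : ∑ y, ∫ ω, w (fun i => Z i ω) y ^ 2 ∂μ ≤ V := by
      calc _ ≤ ∑ _y : S × A, 3600 * (τ + 1) * θ ^ 3 * (1 / (1 - M.γ)) ^ 2 / (k + ξ) := by
            refine Finset.sum_le_sum fun y _ => ?_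
            simp_rw [hwx]
            exact integral_sq_noise_sum_le h hβ hr hd0 hd1 hdm hθ hθh hξ π hQ₀ k τ hτ y
        _ = V := by simp [hV]
    have h3 : V * (1 / (2 * Real.sqrt V)) = Real.sqrt V / 2 := by
      nth_rewrite 1 [← Real.mul_self_sqrt hV0.le]
      field_simp
    have h4 := mul_le_mul_of_nonneg_right h2 (by positivity : 0 ≤ 1 / (2 * Real.sqrt V))
    linarith
  -- the initial part
  have hpart1 : ‖v₀‖ ≤ Real.sqrt ξ / Real.sqrt (k + ξ) * norm2 (QL₀ - M.optQ) := by
    refine (norm_transition_mulVec_le hξ2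
      (fun k v => M.norm_step_le hd0 hd1 hdm hθ hθh hξ π k v) (Nat.zero_le k) _).trans ?_
    refine mul_le_mul ?_ (hnorm _) (norm_nonneg _) (by positivity)
    rw [← Real.sqrt_div (by linarith)]
    have hq0 : 0 ≤ ξ / (k + ξ) := by positivity
    have hq1 : ξ / (k + ξ) ≤ 1 := (div_le_one hN0).2 (by linarith)
    have h1 : ((0 : ℕ) + ξ - 1) / (k + ξ - 1) ≤ ξ / (k + ξ) := by
      rw [div_le_div_iff₀ (by linarith) hN0]
      push_cast
      nlinarith
    have h2 : 0 ≤ ((0 : ℕ) + ξ - 1) / (k + ξ - 1) :=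
      div_nonneg (by push_cast; linarith) (by linarith)
    have h3 : ξ / (k + ξ) ≤ Real.sqrt (ξ / (k + ξ)) := Real.le_sqrt_of_sq_le (by nlinarith)
    refine (pow_le_pow_left₀ h2 h1 2).trans (le_trans ?_ h3)
    nlinarith
  calc _ ≤ ∫ ω, (‖v₀‖ + ‖w (fun i => Z i ω)‖) ∂μ :=
        integral_mono I0 ((integrable_const _).add I1) fun ω => norm_add_le _ _
    _ = ‖v₀‖ + ∫ ω, ‖w (fun i => Z i ω)‖ ∂μ := by
        rw [integral_add (integrable_const _) I1]
        simp
    _ ≤ _ := add_le_add hpart1 hpart2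

end Main

/-! ### Conversion of the constants. -/

lemma sq_rpow_three_halves {x : ℝ} (hx : 0 ≤ x) : (x ^ (3 / 2 : ℝ)) ^ 2 = x ^ 3 := by
  rw [← Real.rpow_natCast, ← Real.rpow_mul hx, ← Real.rpow_natCast]
  norm_num

lemma sqrt_le_of_le_initial_const {c ξ n g dmin dmax : ℝ} (hc : 0 ≤ c) (hn : 0 ≤ n) (hg : 0 ≤ g)
    (hmin : 0 ≤ dmin) (hmax : 0 ≤ dmax) (h : ξ ≤ c * (n ^ 6 * dmax ^ 3 / (g ^ 3 * dmin ^ 3))) :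
    Real.sqrt ξ ≤ Real.sqrt c *
      (n ^ 3 * dmax ^ (3 / 2 : ℝ) / (g ^ (3 / 2 : ℝ) * dmin ^ (3 / 2 : ℝ))) := by
  refine (Real.sqrt_le_sqrt h).trans (le_of_eq ?_)
  rw [Real.sqrt_mul hc]
  congr 1
  rw [← Real.sqrt_sq (by positivity :
    0 ≤ n ^ 3 * dmax ^ (3 / 2 : ℝ) / (g ^ (3 / 2 : ℝ) * dmin ^ (3 / 2 : ℝ))), div_pow, mul_pow,
    mul_pow, sq_rpow_three_halves hmax, sq_rpow_three_halves hg, sq_rpow_three_halves hmin]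
  ring_nf

/-- Since `g * dmin ≤ 1`, its third power in the bound for `θ ^ 3` may be weakened to the fourth,
which makes the radicand a square in `n`, `g` and `dmin`. -/
lemma sqrt_le_noise_const {c θ n g dmin N τ : ℝ} (hc : 0 ≤ c) (hn : 0 ≤ n) (hg : 0 < g)
    (hmin : 0 < dmin) (hh : g * dmin ≤ 1) (hN : 0 < N) (hτ : 0 ≤ τ) (hθ0 : 0 ≤ θ)
    (hθ : θ ≤ c * (n / (g * dmin))) :
    Real.sqrt (n * (3600 * (τ + 1) * θ ^ 3 * (1 / g) ^ 2 / N))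
      ≤ 60 * Real.sqrt (c ^ 3) * (n ^ 2 / (g ^ 3 * dmin ^ 2))
        * ((Real.sqrt τ + 1) / Real.sqrt N) := by
  refine Real.sqrt_le_iff.2 ⟨by positivity, ?_⟩
  have h1 : θ ^ 3 ≤ c ^ 3 * n ^ 3 / (g * dmin) ^ 4 := by
    refine (pow_le_pow_left₀ hθ0 hθ 3).trans ?_
    rw [mul_pow, div_pow, mul_div_assoc]
    refine mul_le_mul_of_nonneg_left (div_le_div_of_nonneg_left (by positivity) (by positivity)
      ?_) (by positivity)
    exact pow_le_pow_of_le_one (by positivity) hh (by norm_num)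
  have h2 : τ + 1 ≤ (Real.sqrt τ + 1) ^ 2 := by
    have := Real.sq_sqrt hτ
    nlinarith [Real.sqrt_nonneg τ]
  have e : (60 * Real.sqrt (c ^ 3) * (n ^ 2 / (g ^ 3 * dmin ^ 2))
        * ((Real.sqrt τ + 1) / Real.sqrt N)) ^ 2
      = n * (3600 * (Real.sqrt τ + 1) ^ 2 * (c ^ 3 * n ^ 3 / (g * dmin) ^ 4) * (1 / g) ^ 2 / N) := by
    have e1 : Real.sqrt (c ^ 3) ^ 2 = c ^ 3 := Real.sq_sqrt (by positivity)
    have e2 : Real.sqrt N ^ 2 = N := Real.sq_sqrt hN.le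
    rw [mul_pow, mul_pow, mul_pow, div_pow _ (Real.sqrt N), e1, e2]
    field_simp
    ring
  rw [e]
  gcongr

/-- The constants of the two error terms combine into the stated form. -/
lemma error_terms_le {a b n D A e t sN : ℝ} (ha : 0 ≤ a) (hb : 0 ≤ b) (hn : 1 ≤ n) (hD : 0 < D)
    (ht : 0 ≤ t) (hN : 0 < sN) :
    a * A / sN * e + b * (n ^ 2 / D) * ((t + 1) / sN)
      ≤ (a + b) * max (A * e) (n ^ (11 / 4 : ℝ) / D) / sN
        + (a + b) * n ^ (25 / 8 : ℝ) / D * (t / sN) := by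
  -- The noise term needs only `n ^ 2`. In `t + 1`, the `1` goes into the maximum and `t` into the
  -- mixing-time term.
  have p1 : n ^ 2 ≤ n ^ (11 / 4 : ℝ) := by
    rw [← Real.rpow_natCast]
    exact Real.rpow_le_rpow_of_exponent_le hn (by norm_num)
  have p2 : n ^ 2 ≤ n ^ (25 / 8 : ℝ) := by
    rw [← Real.rpow_natCast]
    exact Real.rpow_le_rpow_of_exponent_le hn (by norm_num)
  set m := max (A * e) (n ^ (11 / 4 : ℝ) / D) with hm
  have m1 : A * e ≤ m := le_max_left _ _
  have m2 : n ^ 2 / D ≤ m := (div_le_div_of_nonneg_right p1 hD.le).trans (le_max_right _ _)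
  have h1 : a * (A * e) + b * (n ^ 2 / D) ≤ (a + b) * m := by
    have := mul_le_mul_of_nonneg_left m1 ha
    have := mul_le_mul_of_nonneg_left m2 hb
    linarith
  have h2 : b * (n ^ 2 / D) ≤ (a + b) * n ^ (25 / 8 : ℝ) / D := by
    rw [← mul_div_assoc]
    exact div_le_div_of_nonneg_right (mul_le_mul (by linarith) p2 (by positivity) (by positivity))
      hD.le
  calc _ = (a * (A * e) + b * (n ^ 2 / D)) / sN + b * (n ^ 2 / D) * (t / sN) := by
        field_simp
        ring
    _ ≤ _ := add_le_add (div_le_div_of_nonneg_right h1 hN.le)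
      (mul_le_mul_of_nonneg_right h2 (by positivity))

end QLearning

/-! ### The theorem. -/

theorem mainTheorem3 (c : ℝ) (hc : 0 < c) :
    ∃ C : ℝ, 0 < C ∧
      ∀ (S A Ω : Type*) [Fintype S] [Fintype A] [DecidableEq S] [DecidableEq A]
        [MeasurableSpace Ω] (μ : Measure Ω) [IsProbabilityMeasure μ]
        (M : QLearning.MDP S A) (β : S → A → ℝ) (Z : ℕ → Ω → S × A)
        (d : S × A → ℝ) (n dmin dmax θ ξ : ℝ) (α : ℕ → ℝ)
        (π : S → A) (Q₀ QL₀ : S × A → ℝ),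
        -- the Markovian observation model
        (∀ s, β s ∈ stdSimplex ℝ A) →
        (M.chain β).IsIrreducible →
        QLearning.IsAperiodic (M.chain β) →
        QLearning.IsMarkovChain μ (M.chain β) Z →
        d = QLearning.limitLaw μ Z →
        n = Fintype.card S * Fintype.card A →
        dmin = ⨅ x, d x →
        dmax = ⨆ x, d x →
        -- unit bounds on rewards and initial values
        (∀ s a s', |M.r s a s'| ≤ 1) →
        ‖Q₀‖ ≤ 1 →
        ‖QL₀‖ ≤ 1 →
        -- the step-size
        α = QLearning.stepSize θ ξ →
        2 / ((1 - M.γ) * dmin) ≤ θ →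
        θ ≤ c * (n / ((1 - M.γ) * dmin)) →
        θ ≤ ξ →
        ξ ≤ c * (n ^ 6 * dmax ^ 3 / ((1 - M.γ) ^ 3 * dmin ^ 3)) →
        -- the policy in the lower comparison system
        QLearning.IsGreedy M.optQ π →
        (∃ m ρ : ℝ, QLearning.IsMixing (M.chain β) d m ρ) ∧
        ∀ m ρ : ℝ, QLearning.IsMixing (M.chain β) d m ρ →
          ∀ k : ℕ, QLearning.kMix m ρ α ≤ k →
            Integrable
              (fun ω => ‖M.lowerIter d α π Q₀ QL₀ (fun i => Z i ω) k - M.optQ‖) μ ∧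
            ∫ ω, ‖M.lowerIter d α π Q₀ QL₀ (fun i => Z i ω) k - M.optQ‖ ∂μ ≤
              QLearning.constL C n M.γ dmin dmax (QLearning.norm2 (QL₀ - M.optQ)) /
                  Real.sqrt (k + ξ) +
                C * n ^ (25 / 8 : ℝ) / ((1 - M.γ) ^ 3 * dmin ^ 2) *
                  (Real.sqrt (QLearning.mixTime m ρ (α k)) / Real.sqrt (k + ξ)) := by
  refine ⟨Real.sqrt c + 60 * Real.sqrt (c ^ 3), by positivity, ?_⟩
  intro S A Ω _ _ _ _ _ μ _ M β Z d n dmin dmax θ ξ α π Q₀ QL₀ hβ hirr hap hZ hd hn hdmin hdmax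
    hr hQ₀ _ hα hθl hθu hθξ hξu _
  obtain ⟨x₀⟩ : Nonempty (S × A) := by
    obtain ⟨ω⟩ := μ.nonempty_of_neZero
    exact ⟨Z 0 ω⟩
  have : Nonempty (S × A) := ⟨x₀⟩
  have : Nonempty A := ⟨x₀.2⟩
  have hK : M.chain β ∈ Matrix.rowStochastic ℝ (S × A) := QLearning.MDP.chain_mem_rowStochastic hβ
  obtain ⟨p, hp0, m₀, ρ₀, hmix⟩ := QLearning.exists_isMixing hK hirr hap
  -- Identifying the limit law with Doeblin's limit makes `d` strictly positive, hence `dmin > 0`.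
  obtain rfl : d = p := hd.trans (hZ.limitLaw_eq hmix)
  refine ⟨⟨m₀, ρ₀, hmix⟩, fun m ρ hm k _ => ?_⟩
  have hd1 : ∀ x, d x ≤ 1 := fun x => le_of_tendsto (hmix.tendsto x₀ x)
    (Eventually.of_forall fun j =>
      Matrix.le_one_of_mem_rowStochastic (QLearning.pow_mem_rowStochastic hK j))
  have hdm : ∀ x, dmin ≤ d x := fun x => by
    rw [hdmin]
    exact ciInf_le (Set.finite_range d).bddBelow x
  have hdmin0 : 0 < dmin := by
    obtain ⟨y, hy⟩ := Finite.exists_min d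
    rw [hdmin]
    exact (hp0 y).trans_le (le_ciInf hy)
  have hdmax0 : 0 ≤ dmax := by
    rw [hdmax]
    exact (hp0 x₀).le.trans (le_ciSup (Set.finite_range d).bddAbove x₀)
  have hγ : 0 < 1 - M.γ := sub_pos.2 M.γ_lt_one
  have hh0 : 0 < (1 - M.γ) * dmin := mul_pos hγ hdmin0
  have hh1 : (1 - M.γ) * dmin ≤ 1 :=
    mul_le_one₀ (by linarith [M.γ_nonneg]) hdmin0.le ((hdm x₀).trans (hd1 x₀))
  have hθh : 2 ≤ θ * ((1 - M.γ) * dmin) := (div_le_iff₀ hh0).1 hθl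
  have hθ2 : 2 ≤ θ := by
    refine le_trans ?_ hθl
    rw [le_div_iff₀ hh0]
    linarith
  have hcard : n = Fintype.card (S × A) := by
    rw [hn, Fintype.card_prod]
    push_cast
    rfl
  have hn1 : 1 ≤ n := by
    rw [hcard]
    exact_mod_cast Fintype.card_pos_iff.2 ⟨x₀⟩
  have hk0 := Nat.cast_nonneg (α := ℝ) k
  have hN0 : (0 : ℝ) < k + ξ := by linarith
  subst hα
  have hα0 : 0 < QLearning.stepSize θ ξ k := div_pos (by linarith) hN0
  have hτ : ∀ x y, |(M.chain β ^ QLearning.mixTime m ρ (QLearning.stepSize θ ξ k)) x y - d y|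
      ≤ QLearning.stepSize θ ξ k := fun x y =>
    (QLearning.abs_sub_le_tvDist _ _ y).trans
      ((hm.2.2.2 x _).trans (QLearning.mixTime_spec hm.2.1 hm.2.2.1 hα0))
  obtain ⟨hint, hle⟩ := QLearning.integral_norm_lowerIter_le hZ hβ hr (fun x => (hp0 x).le) hd1 hdm
    hθ2 hθh hθξ π hQ₀ QL₀ k _ hτ
  refine ⟨hint, hle.trans ?_⟩
  rw [← hcard]
  set τ := QLearning.mixTime m ρ (QLearning.stepSize θ ξ k)
  have h1 := QLearning.sqrt_le_of_le_initial_const hc.le (by linarith) hγ.le hdmin0.le hdmax0 hξu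
  have h2 := QLearning.sqrt_le_noise_const (τ := τ) hc.le (by linarith) hγ hdmin0 hh1 hN0
    (Nat.cast_nonneg τ) (by linarith) hθu
  have he0 : 0 ≤ QLearning.norm2 (QL₀ - M.optQ) := Real.sqrt_nonneg _
  refine le_trans (add_le_add (mul_le_mul_of_nonneg_right
    (div_le_div_of_nonneg_right h1 (Real.sqrt_nonneg _)) he0) h2) ?_
  exact QLearning.error_terms_le (Real.sqrt_nonneg _) (by positivity) hn1 (by positivity)
    (Real.sqrt_nonneg _) (Real.sqrt_pos.2 hN0)
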